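/- **Setting.** Let $X$ be a real $n\times N$ matrix of full rank $n$ with nonzero columns, regarded as the finite multiset of its columns in $\mathbb{R}^n$; subsets of $X$ are submultisets (obtained by deleting columns), and $\sqcup$ is union of multisets. Let $\Pi=\mathbb{C}[t_1,\dots,t_n]$. For $v\in\mathbb{R}^n$ put $p_v(t)=v\cdot t$ and $D_v=\sum_i v_i\,\partial/\partial t_i$, and for a finite multiset $Y$ of vectors put $p_Y=\prod_{y\in Y}p_y$. Let $\mathbb{I}(X)$ and $\mathbb{B}(X)$ be the collections of linearly independent subsets of $X$ and of subsets of $X$ that are bases of $\mathbb{R}^n$. Let $\mathcal{F}(X)$ be the set of facet hyperplanes, i.e. of the $(n-1)$-dimensional subspaces spanned by subsets of $X$; for $F\in\mathcal{F}(X)$ let $\eta_F\ne 0$ be a normal to $F$ (unique up to a scalar) and $m(F)=\#\{x\in X: x\notin F\}$. For a finite multiset $W\subset\mathbb{R}^n$ let $\mathcal{P}(W)=\mathrm{span}_{\mathbb{C}}\{p_Y: Y\subset W,\ \mathrm{rank}(W\setminus Y)=n\}$. A set $\mathbb{I}'\subset\mathbb{I}(X)$ is *semi-external* if $I\in\mathbb{I}'$,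 $I'\in\mathbb{I}(X)$ and $\mathrm{span}\,I\subset\mathrm{span}\,I'$ imply $I'\in\mathbb{I}'$. For such $\mathbb{I}'$ put $$\mathcal{P}_+(X,\mathbb{I}')=\mathrm{span}_{\mathbb{C}}\{p_Y: Y\subset X,\ Y\cap I=\emptyset\text{ for some } I\in\mathbb{I}'\},$$ $$\mathcal{I}_+(X,\mathbb{I}')=\mathrm{Ideal}\{p_{\eta_F}^{m(F)+1}: F\in\mathcal{F}(X)\}+\mathrm{Ideal}\Big(\bigcup_{S}\Pi^0_{\#(X\setminus S)}(S^\perp)\Big),$$ where $S$ runs over the spans of the sets $I\in\mathbb{I}(X)\setminus\mathbb{I}'$, $\#(X\setminus S)=\#\{x\in X:x\notin S\}$, and $\Pi^0_k(S^\perp)$ is the set of homogeneous $p\in\Pi$ of degree $k$ with $D_v p=0$ for all $v\in S$. For $I\in\mathbb{I}(X)\setminus\mathbb{B}(X)$ let $\mathcal{M}(I)=\{I'\in\mathbb{I}(X): I\subset\mathrm{span}\,I'\in\mathcal{F}(X)\}$. **Theorem 2.8.** Let $\mathbb{I}'$ be a nonempty semi-external set such that, for every $I\in\mathbb{I}(X)\setminus\mathbb{B}(X)$,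 $\mathcal{M}(I)\subset\mathbb{I}'$ implies $I\in\mathbb{I}'$. Then: 1. $\mathcal{I}_+(X,\mathbb{I}')=\mathrm{Ideal}\{p_{\eta_F}^{m(F)+\varepsilon(F)}: F\in\mathcal{F}(X)\}$, where $\varepsilon(F)=1$ if $F=\mathrm{span}\,I$ for some $I\in\mathbb{I}'$, and $\varepsilon(F)=0$ otherwise. 2. $$\mathcal{P}_+(X,\mathbb{I}')=\sum_{I\text{ minimal in }\mathbb{I}'}\ \bigcap_{Z\in\mathrm{Comp}_I(X)}\mathcal{P}(X\sqcup Z),$$ where $I$ is minimal in $\mathbb{I}'$ if $I\in\mathbb{I}'$ and no proper subset of $I$ is in $\mathbb{I}'$, and $\mathrm{Comp}_I(X)=\{Z\subset X: I\cup Z\in\mathbb{B}(X)\}$. -/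

import Mathlib

/-! Throughout, the multiset `X` of columns of an `n × N` real matrix is a family
`X : ι → Fin n → ℝ` over a finite index type `ι`; submultisets of `X` are finsets of indices.
The polynomial ring is `ℂ[t₁, …, tₙ] = MvPolynomial (Fin n) ℂ`. -/

namespace Zonotopal

open scoped Matrix

noncomputable section

/-- The linear polynomial `p_v(t) = v · t`. -/
def linPoly {n : ℕ} (v : Fin n → ℝ) : MvPolynomial (Fin n) ℂ :=
  ∑ i, MvPolynomial.C ((v i : ℝ) : ℂ) * MvPolynomial.X i

/-- The directional derivative `D_v` on polynomials. -/
def dirDeriv {n : ℕ} (v : Fin n → ℝ) (p : MvPolynomial (Fin n) ℂ) : MvPolynomial (Fin n) ℂ :=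
  ∑ i, MvPolynomial.C ((v i : ℝ) : ℂ) * MvPolynomial.pderiv i p

/-- The product `p_Y = ∏_{y ∈ Y} p_y` over a submultiset `Y` of `X`. -/
def prodPoly {n : ℕ} {ι : Type*} (X : ι → Fin n → ℝ) (Y : Finset ι) :
    MvPolynomial (Fin n) ℂ :=
  ∏ i ∈ Y, linPoly (X i)

/-- The linear span in `ℝⁿ` of a submultiset `Y` of `X`. -/
def spanOf {n : ℕ} {ι : Type*} (X : ι → Fin n → ℝ) (Y : Finset ι) :
    Submodule ℝ (Fin n → ℝ) :=
  Submodule.span ℝ (X '' (Y : Set ι))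

/-- `𝕀(X)`: the linearly independent submultisets of `X`. -/
def indepSets {n : ℕ} {ι : Type*} (X : ι → Fin n → ℝ) : Set (Finset ι) :=
  {I | LinearIndependent ℝ (fun i : I => X i)}

/-- `𝔹(X)`: the submultisets of `X` that are bases of `ℝⁿ`. -/
def bases {n : ℕ} {ι : Type*} (X : ι → Fin n → ℝ) : Set (Finset ι) :=
  {B | B ∈ indepSets X ∧ spanOf X B = ⊤}

/-- `𝓕(X)`: the facet hyperplanes, i.e. the spans of submultisets of rank `n - 1`. -/
def facets {n : ℕ} {ι : Type*} (X : ι → Fin n → ℝ) : Set (Submodule ℝ (Fin n → ℝ)) :=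
  {F | (∃ Y : Finset ι, F = spanOf X Y) ∧ Module.finrank ℝ F + 1 = n}

/-- `#(X \ S)`: the number of members of the multiset `X` outside the subspace `S`.
For a facet hyperplane `F` this is the multiplicity `m(F)`. -/
def mult {n : ℕ} {ι : Type*} (X : ι → Fin n → ℝ) (S : Submodule ℝ (Fin n → ℝ)) : ℕ :=
  {i | X i ∉ S}.ncard

/-- The ideal generated by the powers `p_{η_F}^{m(F) + e(F)}`, `F ∈ 𝓕(X)`. The normal `η_F` is
defined only up to a nonzero scalar; all nonzero normals are used here, and any choice of one
normal for each `F` generates the same ideal. -/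
def facetIdeal {n : ℕ} {ι : Type*} (X : ι → Fin n → ℝ)
    (e : Submodule ℝ (Fin n → ℝ) → ℕ) : Ideal (MvPolynomial (Fin n) ℂ) :=
  Ideal.span {f | ∃ F ∈ facets X, ∃ η : Fin n → ℝ, η ≠ 0 ∧ (∀ v ∈ F, η ⬝ᵥ v = 0) ∧
    f = linPoly η ^ (mult X F + e F)}

/-- The external ideal `ℐ₊(X)`. -/
def extIdeal {n : ℕ} {ι : Type*} (X : ι → Fin n → ℝ) : Ideal (MvPolynomial (Fin n) ℂ) :=
  facetIdeal X (fun _ => 1)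

/-- `Π⁰_k(S⊥)`: the homogeneous polynomials of degree `k` on the orthogonal complement of `S`,
i.e. those annihilated by `D_v` for all `v ∈ S`. -/
def homogPolysOnPerp {n : ℕ} (k : ℕ) (S : Submodule ℝ (Fin n → ℝ)) :
    Set (MvPolynomial (Fin n) ℂ) :=
  {p | p.IsHomogeneous k ∧ ∀ v ∈ S, dirDeriv v p = 0}

/-- A collection `E` of independent submultisets of `X` is semi-external. -/
def IsSemiExternal {n : ℕ} {ι : Type*} (X : ι → Fin n → ℝ) (E : Set (Finset ι)) : Prop :=
  E ⊆ indepSets X ∧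
    ∀ I ∈ E, ∀ J ∈ indepSets X, spanOf X I ≤ spanOf X J → J ∈ E

/-- `S(X, E)`: the spans of the independent submultisets that are not in `E`. -/
def missingSpans {n : ℕ} {ι : Type*} (X : ι → Fin n → ℝ) (E : Set (Finset ι)) :
    Set (Submodule ℝ (Fin n → ℝ)) :=
  {S | ∃ I ∈ indepSets X, I ∉ E ∧ S = spanOf X I}

/-- The semi-external ideal `ℐ₊(X, E)`. -/
def semiExtIdeal {n : ℕ} {ι : Type*} (X : ι → Fin n → ℝ) (E : Set (Finset ι)) :
    Ideal (MvPolynomial (Fin n) ℂ) :=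
  extIdeal X + Ideal.span (⋃ S ∈ missingSpans X E, homogPolysOnPerp (mult X S) S)

/-- The semi-external space `𝒫₊(X, E)`. -/
def semiExtSpace {n : ℕ} {ι : Type*} (X : ι → Fin n → ℝ) (E : Set (Finset ι)) :
    Submodule ℂ (MvPolynomial (Fin n) ℂ) :=
  Submodule.span ℂ {f | ∃ Y : Finset ι, (∃ I ∈ E, Disjoint Y I) ∧ f = prodPoly X Y}

/-- The central space `𝒫(X)`, spanned by the `p_Y` with `X \ Y` of rank `n`. -/
def centralSpace {n : ℕ} {ι : Type*} (X : ι → Fin n → ℝ) :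
    Submodule ℂ (MvPolynomial (Fin n) ℂ) :=
  Submodule.span ℂ {f | ∃ Y : Finset ι,
    Submodule.span ℝ (X '' ((Y : Set ι)ᶜ)) = ⊤ ∧ f = prodPoly X Y}

/-- The multiset union `X ⊔ Z` for a submultiset `Z` of `X`: every member of `Z` is listed once
more. -/
def augment {n : ℕ} {ι : Type*} (X : ι → Fin n → ℝ) (Z : Finset ι) :
    ι ⊕ Z → Fin n → ℝ :=
  Sum.elim X (fun z => X z)

/-- `ℳ(I)`: the independent submultisets that span a facet hyperplane containing `I`. -/
def facetExtensions {n : ℕ} {ι : Type*} (X : ι → Fin n → ℝ) (I : Finset ι) :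
    Set (Finset ι) :=
  {J | J ∈ indepSets X ∧ (∀ i ∈ I, X i ∈ spanOf X J) ∧ spanOf X J ∈ facets X}

open Classical in
/-- `ε(F) = 1` if `F` is the span of a member of `E`, and `ε(F) = 0` otherwise. -/
def eps {n : ℕ} {ι : Type*} (X : ι → Fin n → ℝ) (E : Set (Finset ι))
    (F : Submodule ℝ (Fin n → ℝ)) : ℕ :=
  if ∃ I ∈ E, F = spanOf X I then 1 else 0

/-- `Comp_I(X)`: the completions of `I` to a basis. -/
def completions {n : ℕ} {ι : Type*} [DecidableEq ι] (X : ι → Fin n → ℝ) (I : Finset ι) :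
    Set (Finset ι) :=
  {Z | I ∪ Z ∈ bases X}

end

end Zonotopal

namespace Zonotopal

open scoped Matrix Nat

open MvPolynomial

/-! ### Linear polynomials and directional derivatives -/

/-! Both parts rest on one kernel description, `facetKernel_le_remainderSpace`. Fix a subspace `U`
and a spanning family. A polynomial killed by `D_η ^ (m(F) + [U ⊆ F])` for all facet hyperplanes `F
= η⊥` is a combination of products `p_Y` whose remaining vectors span at least `U`. The case `U = ⊤`
is the central situation, `U = ⊥` the external one. The proof is by deletion and contraction of a
vector `x`: contraction determines `f` modulo `p_x`, and deletion treats the quotient.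

The space: if `I ∈ E` and `f` lies in all `𝒫(X ⊔ Z)` with `Z` a completion of `I`, then for each
facet `F` one chooses `Z` with at most `[span I ⊆ F]` vectors off `F` (`exists_completion`). This
places `f` in the kernel for `U = span I`, so `f` is a combination of `p_Y` with `span I ⊆ span (X \
Y)`. A basis of the latter span chosen from `X \ Y` is in `E` by semi-externality. The reverse
inclusion is direct (`semiExtSpace_le`).

The ideal: for `I ∉ E`, the hypothesis on `ℳ(I)` gives a facet `F₀ ⊇ S = span I` with `ε(F₀) = 0`.
Modulo `S`, what must be shown is that an ideal containing all `p_η ^ (m(F) + 1)` and one `p_η ^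
m(F)` contains every form whose degree is the number of vectors (`mem_ideal_of_facet_powers`). By
apolarity this says that no nonzero form of that degree is killed by the corresponding derivatives.
The external kernel has only the multiples of the full product in that degree, and the extra
derivative does not kill the full product. -/

theorem linPoly_add {n : ℕ} (v w : Fin n → ℝ) : linPoly (v + w) = linPoly v + linPoly w := by
  simp [linPoly, add_mul, Finset.sum_add_distrib]

theorem linPoly_smul {n : ℕ} (a : ℝ) (v : Fin n → ℝ) :
    linPoly (a • v) = C ((a : ℝ) : ℂ) * linPoly v := by
  simp [linPoly, mul_assoc, Finset.mul_sum]

theorem linPoly_sub {n : ℕ} (v w : Fin n → ℝ) : linPoly (v - w) = linPoly v - linPoly w := by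
  simp [linPoly, sub_mul, Finset.sum_sub_distrib]

@[simp]
theorem linPoly_zero {n : ℕ} : linPoly (0 : Fin n → ℝ) = 0 := by
  simp [linPoly]

theorem linPoly_sum {n : ℕ} {κ : Type*} (s : Finset κ) (v : κ → Fin n → ℝ) :
    linPoly (∑ k ∈ s, v k) = ∑ k ∈ s, linPoly (v k) := by
  classical
  induction s using Finset.induction_on with
  | empty => simp
  | insert a s ha ih => rw [Finset.sum_insert ha, Finset.sum_insert ha, linPoly_add, ih]

theorem linPoly_single {n : ℕ} (i : Fin n) :
    linPoly (Pi.single i 1 : Fin n → ℝ) = X i := by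
  unfold linPoly
  rw [Finset.sum_eq_single i]
  · simp
  · intro j _ hj; simp [hj]
  · simp

theorem linPoly_ne_zero {n : ℕ} {v : Fin n → ℝ} (hv : v ≠ 0) : linPoly v ≠ 0 := by
  obtain ⟨i, hi⟩ := Function.ne_iff.1 hv
  intro h
  have := congrArg (coeff (Finsupp.single i 1)) h
  simp only [linPoly, coeff_sum, coeff_C_mul, coeff_X, coeff_zero] at this
  rw [Finset.sum_eq_single i] at this
  · simp at this
    exact hi this
  · intro j _ hj
    simp [Finsupp.single_left_inj, hj]
  · simp

theorem linPoly_isHomogeneous {n : ℕ} (v : Fin n → ℝ) : (linPoly v).IsHomogeneous 1 := by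
  refine IsHomogeneous.sum _ _ _ fun i _ => ?_
  simpa using (isHomogeneous_C (Fin n) ((v i : ℝ) : ℂ)).mul (isHomogeneous_X ℂ i)

theorem prodPoly_isHomogeneous {n : ℕ} {ι : Type*} (X : ι → Fin n → ℝ) (Y : Finset ι) :
    (prodPoly X Y).IsHomogeneous Y.card := by
  simpa [prodPoly] using IsHomogeneous.prod Y _ (fun _ => 1) fun i _ => linPoly_isHomogeneous (X i)

/-- The directional derivative `D_v` as a derivation. -/
noncomputable def dirDerivation {n : ℕ} (v : Fin n → ℝ) :
    Derivation ℂ (MvPolynomial (Fin n) ℂ) (MvPolynomial (Fin n) ℂ) :=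
  ∑ i, ((v i : ℝ) : ℂ) • pderiv i

/-- The directional derivative `D_v` as an endomorphism. -/
noncomputable def dirDerivEnd {n : ℕ} (v : Fin n → ℝ) : Module.End ℂ (MvPolynomial (Fin n) ℂ) :=
  (dirDerivation v).toLinearMap

theorem dirDerivEnd_eq_sum {n : ℕ} (v : Fin n → ℝ) (p : MvPolynomial (Fin n) ℂ) :
    dirDerivEnd v p = ∑ i, ((v i : ℝ) : ℂ) • pderiv i p := by
  have h := congrFun (map_sum (Derivation.coeFnAddMonoidHom (R := ℂ)
    (A := MvPolynomial (Fin n) ℂ) (M := MvPolynomial (Fin n) ℂ))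
    (fun i => ((v i : ℝ) : ℂ) • pderiv i) Finset.univ) p
  rw [Finset.sum_apply] at h
  exact h

theorem dirDerivEnd_apply {n : ℕ} (v : Fin n → ℝ) (p : MvPolynomial (Fin n) ℂ) :
    dirDerivEnd v p = dirDeriv v p := by
  simp [dirDerivEnd_eq_sum, dirDeriv, smul_eq_C_mul]

theorem dirDerivEnd_mul {n : ℕ} (v : Fin n → ℝ) (p q : MvPolynomial (Fin n) ℂ) :
    dirDerivEnd v (p * q) = p * dirDerivEnd v q + q * dirDerivEnd v p := by
  simp [dirDerivEnd, Derivation.leibniz]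

@[simp]
theorem dirDerivEnd_C {n : ℕ} (v : Fin n → ℝ) (a : ℂ) : dirDerivEnd v (C a) = 0 := by
  simp [dirDerivEnd_eq_sum]

@[simp]
theorem dirDerivEnd_one {n : ℕ} (v : Fin n → ℝ) : dirDerivEnd v 1 = 0 := by
  simpa using dirDerivEnd_C v 1

theorem dirDerivEnd_X {n : ℕ} (v : Fin n → ℝ) (i : Fin n) :
    dirDerivEnd v (X i) = C ((v i : ℝ) : ℂ) := by
  rw [dirDerivEnd_eq_sum, Finset.sum_eq_single i]
  · simp [smul_eq_C_mul]
  · intro j _ hj; rw [pderiv_X_of_ne hj.symm, smul_zero]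
  · simp

theorem dirDerivEnd_linPoly {n : ℕ} (v w : Fin n → ℝ) :
    dirDerivEnd v (linPoly w) = C ((v ⬝ᵥ w : ℝ) : ℂ) := by
  simp [linPoly, dirDerivEnd_mul, dirDerivEnd_X, dotProduct, mul_comm]

theorem dirDerivEnd_add_left {n : ℕ} (v w : Fin n → ℝ) (p : MvPolynomial (Fin n) ℂ) :
    dirDerivEnd (v + w) p = dirDerivEnd v p + dirDerivEnd w p := by
  simp [dirDerivEnd_eq_sum, add_smul, Finset.sum_add_distrib]

theorem dirDerivEnd_sum_smul_left {n : ℕ} {κ : Type*} (s : Finset κ) (a : κ → ℝ)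
    (v : κ → Fin n → ℝ) (p : MvPolynomial (Fin n) ℂ) :
    dirDerivEnd (∑ k ∈ s, a k • v k) p = ∑ k ∈ s, ((a k : ℝ) : ℂ) • dirDerivEnd (v k) p := by
  simp only [dirDerivEnd_eq_sum, Finset.smul_sum, smul_smul, Finset.sum_apply, Pi.smul_apply,
    smul_eq_mul, Complex.ofReal_sum, Complex.ofReal_mul, Finset.sum_smul]
  rw [Finset.sum_comm]

theorem dirDerivEnd_single {n : ℕ} (i : Fin n) (p : MvPolynomial (Fin n) ℂ) :
    dirDerivEnd (Pi.single i 1) p = pderiv i p := by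
  rw [dirDerivEnd_eq_sum, Finset.sum_eq_single i]
  · simp
  · intro j _ hj; simp [hj]
  · simp

theorem dirDerivEnd_comm {n : ℕ} (v w : Fin n → ℝ) (p : MvPolynomial (Fin n) ℂ) :
    dirDerivEnd v (dirDerivEnd w p) = dirDerivEnd w (dirDerivEnd v p) := by
  induction p using MvPolynomial.induction_on with
  | C a => simp
  | add p q hp hq => simp [hp, hq]
  | mul_X p i hp =>
    simp only [dirDerivEnd_mul, dirDerivEnd_X, hp, map_add, dirDerivEnd_C]
    ring

theorem dirDerivEnd_isHomogeneous {n : ℕ} (v : Fin n → ℝ) {p : MvPolynomial (Fin n) ℂ} {k : ℕ}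
    (hp : p.IsHomogeneous k) : (dirDerivEnd v p).IsHomogeneous (k - 1) := by
  rw [dirDerivEnd_eq_sum]
  refine IsHomogeneous.sum _ _ _ fun i _ => ?_
  rw [smul_eq_C_mul]
  simpa using (isHomogeneous_C (Fin n) ((v i : ℝ) : ℂ)).mul (hp.pderiv (i := i))

/-! ### Iterated derivatives of a multiple of a linear polynomial -/

/-- Leibniz' rule stops after two terms because `D_η p_x` is constant. -/
theorem dirDerivEnd_pow_succ_linPoly_mul {n : ℕ} (η x : Fin n → ℝ) (g : MvPolynomial (Fin n) ℂ)
    (k : ℕ) :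
    (dirDerivEnd η ^ (k + 1)) (linPoly x * g) =
      linPoly x * (dirDerivEnd η ^ (k + 1)) g +
        C (((k + 1 : ℕ) : ℂ) * ((η ⬝ᵥ x : ℝ) : ℂ)) * (dirDerivEnd η ^ k) g := by
  induction k with
  | zero => simp [dirDerivEnd_mul, dirDerivEnd_linPoly, mul_comm, add_comm]
  | succ k ih =>
    have hD : ∀ l, (dirDerivEnd η ^ (l + 1)) g = dirDerivEnd η ((dirDerivEnd η ^ l) g) :=
      fun l => by rw [pow_succ', Module.End.mul_apply]
    rw [hD (k + 1), pow_succ', Module.End.mul_apply, ih, map_add, dirDerivEnd_mul,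
      dirDerivEnd_mul, dirDerivEnd_linPoly, dirDerivEnd_C, hD k]
    simp only [mul_zero, add_zero, Nat.cast_add, Nat.cast_one, C_mul, C_add, map_one]
    ring

theorem dirDerivEnd_pow_linPoly_mul_of_perp {n : ℕ} {η x : Fin n → ℝ} (h : η ⬝ᵥ x = 0)
    (g : MvPolynomial (Fin n) ℂ) (k : ℕ) :
    (dirDerivEnd η ^ k) (linPoly x * g) = linPoly x * (dirDerivEnd η ^ k) g := by
  cases k with
  | zero => simp
  | succ k => simp [dirDerivEnd_pow_succ_linPoly_mul, h]

theorem dirDerivEnd_pow_eq_zero_of_le {n : ℕ} {η : Fin n → ℝ} {g : MvPolynomial (Fin n) ℂ}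
    {k l : ℕ} (hkl : k ≤ l) (h : (dirDerivEnd η ^ k) g = 0) : (dirDerivEnd η ^ l) g = 0 := by
  obtain ⟨d, rfl⟩ := Nat.exists_eq_add_of_le hkl
  rw [add_comm, pow_add, Module.End.mul_apply, h, map_zero]

theorem exists_dirDerivEnd_pow_eq_zero {n : ℕ} (η : Fin n → ℝ) (g : MvPolynomial (Fin n) ℂ) :
    ∃ k, (dirDerivEnd η ^ k) g = 0 := by
  induction g using MvPolynomial.induction_on with
  | C a => exact ⟨1, by simp⟩
  | add p q hp hq =>
    obtain ⟨k, hk⟩ := hp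
    obtain ⟨l, hl⟩ := hq
    refine ⟨max k l, ?_⟩
    rw [map_add, dirDerivEnd_pow_eq_zero_of_le (le_max_left k l) hk,
      dirDerivEnd_pow_eq_zero_of_le (le_max_right k l) hl, add_zero]
  | mul_X p i hp =>
    obtain ⟨k, hk⟩ := hp
    refine ⟨k + 1, ?_⟩
    rw [mul_comm, ← linPoly_single, dirDerivEnd_pow_succ_linPoly_mul, hk,
      dirDerivEnd_pow_eq_zero_of_le k.le_succ hk]
    simp

/-- A factor not constant along `η` raises the nilpotency order of `D_η` by exactly one, so dividing
by it lowers the order by one. -/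
theorem dirDerivEnd_pow_eq_zero_of_linPoly_mul {n : ℕ} {η x : Fin n → ℝ} (h : η ⬝ᵥ x ≠ 0)
    {g : MvPolynomial (Fin n) ℂ} {k : ℕ}
    (hg : (dirDerivEnd η ^ (k + 1)) (linPoly x * g) = 0) : (dirDerivEnd η ^ k) g = 0 := by
  classical
  have hex := exists_dirDerivEnd_pow_eq_zero η g
  by_contra hne
  have hk : k < Nat.find hex := by
    by_contra hle
    exact hne (dirDerivEnd_pow_eq_zero_of_le (not_lt.1 hle) (Nat.find_spec hex))
  obtain ⟨d, hd⟩ := Nat.exists_eq_add_of_lt hk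
  have hspec := Nat.find_spec hex
  have hmin : (dirDerivEnd η ^ (k + d)) g ≠ 0 := Nat.find_min hex (by omega)
  rw [hd] at hspec
  have h0 : (dirDerivEnd η ^ (k + d + 1)) (linPoly x * g) = 0 :=
    dirDerivEnd_pow_eq_zero_of_le (by omega) hg
  -- At the exact order of `g` the first Leibniz term vanishes, leaving a nonzero scalar times the
  -- last nonzero derivative of `g`.
  rw [dirDerivEnd_pow_succ_linPoly_mul, hspec, mul_zero, zero_add] at h0
  rcases mul_eq_zero.1 h0 with h1 | h1
  · rw [C_eq_zero, mul_eq_zero] at h1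
    rcases h1 with h1 | h1
    · exact absurd h1 (Nat.cast_ne_zero.2 (Nat.succ_ne_zero _))
    · exact h (by exact_mod_cast h1)
  · exact hmin h1

/-- The order of vanishing of `D_η` on `p_Y` is one more than the number of factors of `p_Y` that
are not constant along `η`. -/
theorem dirDerivEnd_pow_prodPoly_eq_zero {n : ℕ} {ι : Type*} (X : ι → Fin n → ℝ)
    (η : Fin n → ℝ) (Y : Finset ι) :
    (dirDerivEnd η ^ ((Y.filter fun i => η ⬝ᵥ X i ≠ 0).card + 1)) (prodPoly X Y) = 0 := by
  classical
  induction Y using Finset.induction_on with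
  | empty => simp [prodPoly]
  | insert a s ha ih =>
    rw [prodPoly, Finset.prod_insert ha, ← prodPoly, Finset.filter_insert]
    by_cases h : η ⬝ᵥ X a = 0
    · simp only [h, ne_eq, not_true_eq_false, if_false]
      rw [dirDerivEnd_pow_linPoly_mul_of_perp h, ih, mul_zero]
    · simp only [h, ne_eq, not_false_eq_true, if_true]
      rw [Finset.card_insert_of_notMem (by simp [ha]), dirDerivEnd_pow_succ_linPoly_mul, ih,
        dirDerivEnd_pow_eq_zero_of_le (Nat.le_succ _) ih]
      simp

/-- Factors constant along `η` pass through `D_η` and are nonzero; each other factor raises the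
order by exactly one. -/
theorem dirDerivEnd_pow_prodPoly_ne_zero {n : ℕ} {ι : Type*} (X : ι → Fin n → ℝ)
    (η : Fin n → ℝ) (Y : Finset ι) (hY : ∀ i ∈ Y, X i ≠ 0) :
    (dirDerivEnd η ^ (Y.filter fun i => η ⬝ᵥ X i ≠ 0).card) (prodPoly X Y) ≠ 0 := by
  classical
  induction Y using Finset.induction_on with
  | empty => simp [prodPoly]
  | insert a s ha ih =>
    have ih := ih fun i hi => hY i (Finset.mem_insert_of_mem hi)
    rw [prodPoly, Finset.prod_insert ha, ← prodPoly, Finset.filter_insert]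
    by_cases h : η ⬝ᵥ X a = 0
    · simp only [h, ne_eq, not_true_eq_false, if_false]
      rw [dirDerivEnd_pow_linPoly_mul_of_perp h]
      exact mul_ne_zero (linPoly_ne_zero (hY a (Finset.mem_insert_self a s))) ih
    · simp only [h, ne_eq, not_false_eq_true, if_true]
      rw [Finset.card_insert_of_notMem (by simp [ha])]
      exact fun h0 => ih (dirDerivEnd_pow_eq_zero_of_linPoly_mul h h0)

/-! ### Linear substitutions -/

/-- The algebra homomorphism that maps `p_v` to `p_{L v}`. -/
noncomputable def linSubst {n m : ℕ} (L : (Fin n → ℝ) →ₗ[ℝ] (Fin m → ℝ)) :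
    MvPolynomial (Fin n) ℂ →ₐ[ℂ] MvPolynomial (Fin m) ℂ :=
  aeval fun i => linPoly (L (Pi.single i 1))

theorem linSubst_linPoly {n m : ℕ} (L : (Fin n → ℝ) →ₗ[ℝ] (Fin m → ℝ)) (v : Fin n → ℝ) :
    linSubst L (linPoly v) = linPoly (L v) := by
  conv_rhs => rw [pi_eq_sum_univ' v, map_sum, linPoly_sum]
  simp only [linPoly, linSubst, map_sum, map_mul, map_smul, aeval_X, algHom_C]
  refine Finset.sum_congr rfl fun i _ => ?_
  simp [Finset.mul_sum, mul_assoc, algebraMap_eq]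

theorem linSubst_prodPoly {n m : ℕ} {ι : Type*} (L : (Fin n → ℝ) →ₗ[ℝ] (Fin m → ℝ))
    (X : ι → Fin n → ℝ) (Y : Finset ι) :
    linSubst L (prodPoly X Y) = prodPoly (fun i => L (X i)) Y := by
  simp [prodPoly, linSubst_linPoly]

theorem linSubst_X {n m : ℕ} (L : (Fin n → ℝ) →ₗ[ℝ] (Fin m → ℝ)) (i : Fin n) :
    linSubst L (X i) = linPoly (L (Pi.single i 1)) := by
  simp [linSubst]

theorem linSubst_linSubst {n m k : ℕ} (L : (Fin n → ℝ) →ₗ[ℝ] (Fin m → ℝ))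
    (M : (Fin m → ℝ) →ₗ[ℝ] (Fin k → ℝ)) (f : MvPolynomial (Fin n) ℂ) :
    linSubst M (linSubst L f) = linSubst (M ∘ₗ L) f := by
  induction f using MvPolynomial.induction_on with
  | C a => simp
  | add p q hp hq => simp [hp, hq]
  | mul_X p i hp => simp [hp, linSubst_X, linSubst_linPoly]

/-- This is the chain rule; `h` says that `η` is the transpose of `L` applied to `ξ`. -/
theorem dirDerivEnd_linSubst {n m : ℕ} {L : (Fin n → ℝ) →ₗ[ℝ] (Fin m → ℝ)} {η : Fin n → ℝ}
    {ξ : Fin m → ℝ} (h : ∀ v, η ⬝ᵥ v = ξ ⬝ᵥ L v) (f : MvPolynomial (Fin n) ℂ) :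
    dirDerivEnd ξ (linSubst L f) = linSubst L (dirDerivEnd η f) := by
  induction f using MvPolynomial.induction_on with
  | C a => simp
  | add p q hp hq => simp [hp, hq]
  | mul_X p i hp =>
    simp [dirDerivEnd_mul, hp, linSubst_X, dirDerivEnd_linPoly, ← h, dirDerivEnd_X]

theorem dirDerivEnd_pow_linSubst {n m : ℕ} {L : (Fin n → ℝ) →ₗ[ℝ] (Fin m → ℝ)} {η : Fin n → ℝ}
    {ξ : Fin m → ℝ} (h : ∀ v, η ⬝ᵥ v = ξ ⬝ᵥ L v) (f : MvPolynomial (Fin n) ℂ) (k : ℕ) :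
    (dirDerivEnd ξ ^ k) (linSubst L f) = linSubst L ((dirDerivEnd η ^ k) f) := by
  induction k with
  | zero => simp
  | succ k ih =>
    rw [pow_succ', Module.End.mul_apply, ih, dirDerivEnd_linSubst h, pow_succ',
      Module.End.mul_apply]

/-- The kernel of the substitution along a projection with kernel `ℝ x` is generated by `p_x`. -/
theorem linPoly_dvd_of_linSubst_eq_zero {n m : ℕ} {L : (Fin n → ℝ) →ₗ[ℝ] (Fin m → ℝ)}
    (hL : LinearMap.range L = ⊤) {x : Fin n → ℝ} (hx : LinearMap.ker L = Submodule.span ℝ {x})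
    {f : MvPolynomial (Fin n) ℂ} (hf : linSubst L f = 0) : linPoly x ∣ f := by
  obtain ⟨σ, hσ⟩ := L.exists_rightInverse_of_surjective hL
  -- For a section `σ` of `L`, the vectors `v - σ (L v)` lie in `ker L = ℝ x`, so substituting along
  -- `σ ∘ L` changes nothing modulo `p_x`.
  have key : ∀ g : MvPolynomial (Fin n) ℂ, linPoly x ∣ g - linSubst (σ ∘ₗ L) g := by
    intro g
    induction g using MvPolynomial.induction_on with
    | C a => simp
    | add p q hp hq =>
      rw [map_add, add_sub_add_comm]
      exact dvd_add hp hq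
    | mul_X p i hp =>
      have h1 : (Pi.single i 1 : Fin n → ℝ) - σ (L (Pi.single i 1)) ∈ LinearMap.ker L := by
        have := LinearMap.congr_fun hσ (L (Pi.single i 1))
        simp at this
        simp [this]
      rw [hx, Submodule.mem_span_singleton] at h1
      obtain ⟨a, ha⟩ := h1
      have h2 : linPoly x ∣ X i - linSubst (σ ∘ₗ L) (X i) := by
        rw [linSubst_X, ← linPoly_single, LinearMap.comp_apply, ← linPoly_sub, ← ha, linPoly_smul]
        exact dvd_mul_left _ _
      rw [map_mul]
      have h3 : p * X i - linSubst (σ ∘ₗ L) p * linSubst (σ ∘ₗ L) (X i) =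
          (p - linSubst (σ ∘ₗ L) p) * X i +
            linSubst (σ ∘ₗ L) p * (X i - linSubst (σ ∘ₗ L) (X i)) := by ring
      rw [h3]
      exact dvd_add (hp.mul_right _) (h2.mul_left _)
  have := key f
  rwa [← linSubst_linSubst, hf, map_zero, sub_zero] at this

/-- The transpose of a linear map for the standard dot products. -/
theorem exists_transpose {n m : ℕ} (L : (Fin n → ℝ) →ₗ[ℝ] (Fin m → ℝ)) :
    ∃ A : (Fin m → ℝ) →ₗ[ℝ] (Fin n → ℝ), ∀ ξ v, A ξ ⬝ᵥ v = ξ ⬝ᵥ L v := by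
  refine ⟨(LinearMap.toMatrix' L).vecMulLinear, fun ξ v => ?_⟩
  rw [Matrix.vecMulLinear_apply, ← Matrix.dotProduct_mulVec, LinearMap.toMatrix'_mulVec]

theorem exists_linearMap_ker_eq {n : ℕ} (W : Submodule ℝ (Fin n → ℝ)) :
    ∃ (m : ℕ) (L : (Fin n → ℝ) →ₗ[ℝ] (Fin m → ℝ)), LinearMap.range L = ⊤ ∧ LinearMap.ker L = W := by
  let e := (Module.finBasis ℝ ((Fin n → ℝ) ⧸ W)).equivFun
  refine ⟨_, e.toLinearMap ∘ₗ W.mkQ, ?_, ?_⟩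
  · rw [LinearMap.range_comp, W.range_mkQ, Submodule.map_top, LinearEquiv.range]
  · rw [LinearEquiv.ker_comp, W.ker_mkQ]

/-! ### Facet normals and the deletion-contraction induction -/

/-- `η` is a normal of a facet hyperplane of the subfamily of `X` indexed by `S`. -/
def IsFacetNormal {n : ℕ} {ι : Type*} (X : ι → Fin n → ℝ) (S : Finset ι) (η : Fin n → ℝ) : Prop :=
  η ≠ 0 ∧ ∀ v, η ⬝ᵥ v = 0 → v ∈ Submodule.span ℝ (X '' {i | i ∈ S ∧ η ⬝ᵥ X i = 0})

/-- The number of members of the subfamily indexed by `S` that do not lie on `η⊥`. -/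
noncomputable def normalMult {n : ℕ} {ι : Type*} (X : ι → Fin n → ℝ) (S : Finset ι)
    (η : Fin n → ℝ) : ℕ :=
  (S.filter fun i => η ⬝ᵥ X i ≠ 0).card

open Classical in
/-- `1` if the hyperplane `η⊥` contains `U`, and `0` otherwise. -/
noncomputable def perpIndicator {n : ℕ} (U : Submodule ℝ (Fin n → ℝ)) (η : Fin n → ℝ) : ℕ :=
  if ∀ u ∈ U, η ⬝ᵥ u = 0 then 1 else 0

/-- The polynomials `f` with `D_η ^ (m(F) + [U ⊆ F]) f = 0` for all facet hyperplanes
`F = η⊥`. -/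
noncomputable def facetKernel {n : ℕ} {ι : Type*} (X : ι → Fin n → ℝ) (U : Submodule ℝ (Fin n → ℝ))
    (S : Finset ι) : Submodule ℂ (MvPolynomial (Fin n) ℂ) :=
  ⨅ η ∈ {η | IsFacetNormal X S η},
    LinearMap.ker (dirDerivEnd η ^ (normalMult X S η + perpIndicator U η))

/-- The span of the products `p_Y` for which the remaining vectors of the subfamily indexed by `S`
still span `U`. -/
noncomputable def remainderSpace {n : ℕ} {ι : Type*} (X : ι → Fin n → ℝ) (U : Submodule ℝ (Fin n → ℝ))
    (S : Finset ι) : Submodule ℂ (MvPolynomial (Fin n) ℂ) :=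
  Submodule.span ℂ {f | ∃ Y ⊆ S, U ≤ Submodule.span ℝ (X '' {i | i ∈ S ∧ i ∉ Y}) ∧
    f = prodPoly X Y}

theorem mem_facetKernel {n : ℕ} {ι : Type*} {X : ι → Fin n → ℝ} {U : Submodule ℝ (Fin n → ℝ)}
    {S : Finset ι} {f : MvPolynomial (Fin n) ℂ} :
    f ∈ facetKernel X U S ↔ ∀ η, IsFacetNormal X S η →
      (dirDerivEnd η ^ (normalMult X S η + perpIndicator U η)) f = 0 := by
  simp [facetKernel, Submodule.mem_iInf]

theorem dotProduct_eq_zero_of_mem_span {n : ℕ} {η : Fin n → ℝ} {s : Set (Fin n → ℝ)}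
    (h : ∀ v ∈ s, η ⬝ᵥ v = 0) {v : Fin n → ℝ} (hv : v ∈ Submodule.span ℝ s) : η ⬝ᵥ v = 0 := by
  induction hv using Submodule.span_induction with
  | mem x hx => exact h x hx
  | zero => simp
  | add x y _ _ hx hy => rw [dotProduct_add, hx, hy, add_zero]
  | smul a x _ hx => rw [dotProduct_smul, hx, smul_zero]

/-- If `U` is not inside `η⊥`, some vector outside `Y` is off `η⊥`, so `p_Y` has at most `m - 1`
factors that vary along `η`; otherwise it has at most `m`. -/
theorem prodPoly_mem_ker_of_remainder {n : ℕ} {ι : Type*} {X : ι → Fin n → ℝ}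
    {U : Submodule ℝ (Fin n → ℝ)} {S Y : Finset ι} (hYS : Y ⊆ S)
    (hU : U ≤ Submodule.span ℝ (X '' {i | i ∈ S ∧ i ∉ Y})) (η : Fin n → ℝ) :
    (dirDerivEnd η ^ (normalMult X S η + perpIndicator U η)) (prodPoly X Y) = 0 := by
  classical
  refine dirDerivEnd_pow_eq_zero_of_le ?_ (dirDerivEnd_pow_prodPoly_eq_zero X η Y)
  have hsub : (Y.filter fun i => η ⬝ᵥ X i ≠ 0) ⊆ S.filter fun i => η ⬝ᵥ X i ≠ 0 :=
    Finset.filter_subset_filter _ hYS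
  unfold perpIndicator normalMult
  split_ifs with h
  · exact Nat.succ_le_succ (Finset.card_le_card hsub)
  · push Not at h
    obtain ⟨u, huU, hu⟩ := h
    have : ∃ i, i ∈ S ∧ i ∉ Y ∧ η ⬝ᵥ X i ≠ 0 := by
      by_contra hcon
      push Not at hcon
      refine hu (dotProduct_eq_zero_of_mem_span ?_ (hU huU))
      rintro _ ⟨i, ⟨hiS, hiY⟩, rfl⟩
      exact hcon i hiS hiY
    obtain ⟨i, hiS, hiY, hi⟩ := this
    rw [add_zero]
    refine Finset.card_lt_card (Finset.ssubset_iff_of_subset hsub |>.2 ⟨i, ?_, ?_⟩)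
    · simp [hiS, hi]
    · simp [hiY]

theorem remainderSpace_le_facetKernel {n : ℕ} {ι : Type*} (X : ι → Fin n → ℝ)
    (U : Submodule ℝ (Fin n → ℝ)) (S : Finset ι) :
    remainderSpace X U S ≤ facetKernel X U S := by
  refine Submodule.span_le.2 ?_
  rintro _ ⟨Y, hYS, hU, rfl⟩
  exact mem_facetKernel.2 fun η _ => prodPoly_mem_ker_of_remainder hYS hU η

theorem mem_span_of_mem_map {n m : ℕ} {ι : Type*} {X : ι → Fin n → ℝ}
    {L : (Fin n → ℝ) →ₗ[ℝ] (Fin m → ℝ)} {s t : Set ι} (hst : s ⊆ t)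
    (hker : LinearMap.ker L ≤ Submodule.span ℝ (X '' t)) {v : Fin n → ℝ}
    (hv : L v ∈ Submodule.span ℝ ((fun i => L (X i)) '' s)) : v ∈ Submodule.span ℝ (X '' t) := by
  have himg : (fun i => L (X i)) '' s = L '' (X '' s) := by rw [Set.image_image]
  rw [himg, ← Submodule.map_span] at hv
  obtain ⟨w, hw, hwv⟩ := hv
  have h1 : v - w ∈ LinearMap.ker L := by simp [hwv]
  have h2 := add_mem (hker h1) (Submodule.span_mono (Set.image_mono hst) hw)
  simpa using h2

/-- Preimages of facets of the contracted family are facets of the original one, provided `ker L` is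
spanned by vectors of the family on the hyperplane. -/
theorem isFacetNormal_transpose {n m : ℕ} {ι : Type*} {X : ι → Fin n → ℝ} {S S' : Finset ι}
    (hS : S' ⊆ S) {L : (Fin n → ℝ) →ₗ[ℝ] (Fin m → ℝ)} (hL : LinearMap.range L = ⊤)
    {η : Fin n → ℝ} {ξ : Fin m → ℝ} (h : ∀ v, η ⬝ᵥ v = ξ ⬝ᵥ L v)
    (hker : LinearMap.ker L ≤ Submodule.span ℝ (X '' {i | i ∈ S ∧ η ⬝ᵥ X i = 0}))
    (hξ : IsFacetNormal (fun i => L (X i)) S' ξ) : IsFacetNormal X S η := by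
  refine ⟨?_, fun v hv => ?_⟩
  · rintro rfl
    refine hξ.1 (dotProduct_eq_zero_iff.1 fun w => ?_)
    obtain ⟨v, rfl⟩ := LinearMap.range_eq_top.1 hL w
    rw [← h, zero_dotProduct]
  · refine mem_span_of_mem_map ?_ hker (hξ.2 (L v) (by rw [← h, hv]))
    rintro i ⟨hi, h0⟩
    exact ⟨hS hi, by rw [h, h0]⟩

theorem normalMult_transpose {n m : ℕ} {ι : Type*} {X : ι → Fin n → ℝ} {S : Finset ι}
    {L : (Fin n → ℝ) →ₗ[ℝ] (Fin m → ℝ)} {η : Fin n → ℝ} {ξ : Fin m → ℝ}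
    (h : ∀ v, η ⬝ᵥ v = ξ ⬝ᵥ L v) :
    normalMult (fun i => L (X i)) S ξ = normalMult X S η := by
  simp only [normalMult, h]

theorem perpIndicator_transpose {n m : ℕ} {U : Submodule ℝ (Fin n → ℝ)}
    {L : (Fin n → ℝ) →ₗ[ℝ] (Fin m → ℝ)} {η : Fin n → ℝ} {ξ : Fin m → ℝ}
    (h : ∀ v, η ⬝ᵥ v = ξ ⬝ᵥ L v) :
    perpIndicator (U.map L) ξ = perpIndicator U η := by
  have hiff : (∀ u ∈ U.map L, ξ ⬝ᵥ u = 0) ↔ ∀ u ∈ U, η ⬝ᵥ u = 0 := by simp [h]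
  unfold perpIndicator
  by_cases hU : ∀ u ∈ U, η ⬝ᵥ u = 0
  · rw [if_pos hU, if_pos (hiff.2 hU)]
  · rw [if_neg hU, if_neg (mt hiff.1 hU)]

theorem normalMult_erase_of_perp {n : ℕ} {ι : Type*} [DecidableEq ι] {X : ι → Fin n → ℝ}
    {S : Finset ι} {i : ι} {η : Fin n → ℝ} (h : η ⬝ᵥ X i = 0) :
    normalMult X (S.erase i) η = normalMult X S η := by
  unfold normalMult
  congr 1
  ext j
  simp only [Finset.mem_filter, Finset.mem_erase]
  refine ⟨fun hj => ⟨hj.1.2, hj.2⟩, fun hj => ⟨⟨?_, hj.1⟩, hj.2⟩⟩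
  rintro rfl
  exact hj.2 h

theorem normalMult_erase_of_not_perp {n : ℕ} {ι : Type*} [DecidableEq ι] {X : ι → Fin n → ℝ}
    {S : Finset ι} {i : ι} (hi : i ∈ S) {η : Fin n → ℝ} (h : η ⬝ᵥ X i ≠ 0) :
    normalMult X S η = normalMult X (S.erase i) η + 1 := by
  unfold normalMult
  rw [Finset.filter_erase, Finset.card_erase_add_one]
  simp [hi, h]

/-- Contraction of one vector: modulo `p_x`, polynomials in the kernel are combinations of products
that leave out `x`. -/
theorem exists_remainder_of_contraction {n m : ℕ} {ι : Type*} [DecidableEq ι]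
    {X : ι → Fin n → ℝ} {U : Submodule ℝ (Fin n → ℝ)} {S : Finset ι} {i : ι} (hi : i ∈ S)
    {L : (Fin n → ℝ) →ₗ[ℝ] (Fin m → ℝ)} (hL : LinearMap.range L = ⊤)
    (hker : LinearMap.ker L = Submodule.span ℝ {X i})
    (ih : facetKernel (fun j => L (X j)) (U.map L) (S.erase i) ≤
      remainderSpace (fun j => L (X j)) (U.map L) (S.erase i))
    {f : MvPolynomial (Fin n) ℂ}
    (hf : ∀ η, IsFacetNormal X S η → η ⬝ᵥ X i = 0 →
      (dirDerivEnd η ^ (normalMult X S η + perpIndicator U η)) f = 0) :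
    ∃ h ∈ Submodule.span ℂ {f | ∃ Y ⊆ S.erase i,
      U ≤ Submodule.span ℝ (X '' {j | j ∈ S ∧ j ∉ Y}) ∧ f = prodPoly X Y},
      linPoly (X i) ∣ f - h := by
  have hmem : linSubst L f ∈ facetKernel (fun j => L (X j)) (U.map L) (S.erase i) := by
    refine mem_facetKernel.2 fun ξ hξ => ?_
    obtain ⟨A, hA⟩ := exists_transpose L
    have hAξ := hA ξ
    have hi0 : A ξ ⬝ᵥ X i = 0 := by
      have : X i ∈ LinearMap.ker L := by rw [hker]; exact Submodule.mem_span_singleton_self _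
      rw [hAξ, LinearMap.mem_ker.1 this, dotProduct_zero]
    have hN : IsFacetNormal X S (A ξ) := by
      refine isFacetNormal_transpose (Finset.erase_subset i S) hL hAξ ?_ hξ
      rw [hker]
      exact Submodule.span_mono (Set.singleton_subset_iff.2 ⟨i, ⟨hi, hi0⟩, rfl⟩)
    rw [normalMult_transpose hAξ, perpIndicator_transpose hAξ, normalMult_erase_of_perp hi0,
      dirDerivEnd_pow_linSubst hAξ, hf _ hN hi0, map_zero]
  have hle : remainderSpace (fun j => L (X j)) (U.map L) (S.erase i) ≤
      (Submodule.span ℂ {f | ∃ Y ⊆ S.erase i,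
        U ≤ Submodule.span ℝ (X '' {j | j ∈ S ∧ j ∉ Y}) ∧ f = prodPoly X Y}).map
        (linSubst L).toLinearMap := by
    refine Submodule.span_le.2 ?_
    rintro _ ⟨Y, hY, hU, rfl⟩
    refine ⟨prodPoly X Y, Submodule.subset_span ⟨Y, hY, fun u hu => ?_, rfl⟩,
      linSubst_prodPoly L X Y⟩
    -- The contracted vector is never in `Y`, so it remains and supplies `ker L` when spans are
    -- lifted back.
    have hiY : i ∉ Y := fun h => Finset.notMem_erase i S (hY h)
    refine mem_span_of_mem_map ?_ ?_ (hU (Submodule.mem_map_of_mem hu))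
    · exact fun j hj => ⟨Finset.mem_of_mem_erase hj.1, hj.2⟩
    · rw [hker]
      exact Submodule.span_mono (Set.singleton_subset_iff.2 ⟨i, ⟨hi, hiY⟩, rfl⟩)
  obtain ⟨h, hh, heq⟩ := hle (ih hmem)
  refine ⟨h, hh, linPoly_dvd_of_linSubst_eq_zero hL hker ?_⟩
  rw [map_sub, sub_eq_zero]
  exact heq.symm

theorem span_image_split {n : ℕ} {ι : Type*} [DecidableEq ι] {X : ι → Fin n → ℝ} {s t : Set ι}
    {i : ι} (h : s ⊆ insert i t) {v : Fin n → ℝ} (hv : v ∈ Submodule.span ℝ (X '' s)) :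
    ∃ a : ℝ, ∃ w ∈ Submodule.span ℝ (X '' t), v = a • X i + w := by
  have := Submodule.span_mono (Set.image_mono h) hv
  rw [Set.image_insert_eq, Submodule.mem_span_insert] at this
  exact this

theorem prodPoly_insert_mem_remainderSpace {n : ℕ} {ι : Type*} [DecidableEq ι]
    {X : ι → Fin n → ℝ} {U : Submodule ℝ (Fin n → ℝ)} {S : Finset ι} {i : ι} (hi : i ∈ S)
    {Y : Finset ι} (hY : Y ⊆ S.erase i)
    (hU : U ≤ Submodule.span ℝ (X '' {j | j ∈ S.erase i ∧ j ∉ Y})) :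
    linPoly (X i) * prodPoly X Y ∈ remainderSpace X U S := by
  have hiY : i ∉ Y := fun h => Finset.notMem_erase i S (hY h)
  refine Submodule.subset_span ⟨insert i Y, ?_, hU.trans (Submodule.span_mono
    (Set.image_mono ?_)), ?_⟩
  · exact Finset.insert_subset hi (hY.trans (Finset.erase_subset i S))
  · rintro j ⟨hj, hjY⟩
    rw [Finset.mem_erase] at hj
    exact ⟨hj.2, by simp [hj.1, hjY]⟩
  · rw [prodPoly, prodPoly, Finset.prod_insert hiY]

/-- A nonzero vector orthogonal to a proper subspace. -/
theorem exists_perp_of_ne_top {n : ℕ} {W : Submodule ℝ (Fin n → ℝ)} (hW : W ≠ ⊤) :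
    ∃ η : Fin n → ℝ, η ≠ 0 ∧ ∀ w ∈ W, η ⬝ᵥ w = 0 := by
  obtain ⟨l, hl, hWl⟩ := Submodule.exists_le_ker_of_lt_top W (lt_top_iff_ne_top.2 hW)
  have hdot : ∀ v, (fun i => l (Pi.single i 1)) ⬝ᵥ v = l v := by
    intro v
    conv_rhs => rw [pi_eq_sum_univ' v, map_sum]
    simp [dotProduct, mul_comm]
  refine ⟨fun i => l (Pi.single i 1), fun h => hl ?_, fun w hw => ?_⟩
  · ext1 i
    ext
    simpa using congrFun h i
  · rw [hdot]
    exact hWl hw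

/-- Zero vectors span only if `n = 0`, where every polynomial is a multiple of the empty product. -/
theorem mem_remainderSpace_of_forall_eq_zero {n : ℕ} {ι : Type*} {X : ι → Fin n → ℝ}
    (U : Submodule ℝ (Fin n → ℝ)) {S : Finset ι} (h0 : ∀ i ∈ S, X i = 0)
    (hspan : Submodule.span ℝ (X '' S) = ⊤) (f : MvPolynomial (Fin n) ℂ) :
    f ∈ remainderSpace X U S := by
  have hbot : Submodule.span ℝ (X '' S) = ⊥ := by
    rw [Submodule.span_eq_bot]
    rintro _ ⟨i, hi, rfl⟩
    exact h0 i hi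
  have hzero : ∀ v : Fin n → ℝ, v = 0 := fun v => by
    rw [← Submodule.mem_bot (R := ℝ), ← hbot, hspan]
    trivial
  have : IsEmpty (Fin n) := ⟨fun i => one_ne_zero (congrFun (hzero 1) i)⟩
  rw [eq_C_of_isEmpty f, ← mul_one (C _), ← smul_eq_C_mul]
  refine Submodule.smul_mem _ _ (Submodule.subset_span ⟨∅, by simp, fun u _ => ?_, ?_⟩)
  · rw [hzero u]
    exact zero_mem _
  · simp [prodPoly]

/-- This is the case where deleting `X i` destroys spanning: the other vectors span exactly the
hyperplane `η⊥`, and only `X i` is off it. -/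
theorem isFacetNormal_of_perp_erase {n : ℕ} {ι : Type*} [DecidableEq ι] {X : ι → Fin n → ℝ}
    {S : Finset ι} {i : ι} (hspan : Submodule.span ℝ (X '' S) = ⊤) {η : Fin n → ℝ} (hη : η ≠ 0)
    (hperp : ∀ w ∈ Submodule.span ℝ (X '' (S.erase i : Finset ι)), η ⬝ᵥ w = 0) :
    η ⬝ᵥ X i ≠ 0 ∧
      ∀ v, η ⬝ᵥ v = 0 → v ∈ Submodule.span ℝ (X '' (S.erase i : Finset ι)) := by
  have hsplit : ∀ v, ∃ a : ℝ, ∃ w ∈ Submodule.span ℝ (X '' (S.erase i : Finset ι)),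
      v = a • X i + w := fun v => by
    refine span_image_split (s := (S : Set ι)) ?_ (by rw [hspan]; trivial)
    intro j hj
    by_cases hji : j = i
    · exact Or.inl hji
    · exact Or.inr (by simpa [hji] using hj)
  have hx : η ⬝ᵥ X i ≠ 0 := by
    intro h
    refine hη (dotProduct_eq_zero_iff.1 fun v => ?_)
    obtain ⟨a, w, hw, rfl⟩ := hsplit v
    simp [dotProduct_add, h, hperp w hw]
  refine ⟨hx, fun v hv => ?_⟩
  obtain ⟨a, w, hw, rfl⟩ := hsplit v
  simp only [dotProduct_add, dotProduct_smul, hperp w hw, smul_eq_mul, add_zero, mul_eq_zero, hx,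
    or_false] at hv
  simpa [hv] using hw

/-- If the vectors of the family indexed by `S` span the whole space, then the polynomials
annihilated by the powers `D_η ^ (m(F) + [U ⊆ F])` are spanned by the products `p_Y` for which the
remaining vectors span `U`. -/
theorem facetKernel_le_remainderSpace {n : ℕ} {ι : Type*} [DecidableEq ι]
    (X : ι → Fin n → ℝ) (U : Submodule ℝ (Fin n → ℝ)) (S : Finset ι)
    (hspan : Submodule.span ℝ (X '' S) = ⊤) : facetKernel X U S ≤ remainderSpace X U S := by
  -- Contraction replaces the ambient space by a quotient, so `n` varies in the induction.
  induction hN : S.card generalizing n S with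
  | zero =>
    obtain rfl := Finset.card_eq_zero.1 hN
    exact fun f _ => mem_remainderSpace_of_forall_eq_zero U (by simp) hspan f
  | succ N ih =>
    intro f hf
    by_cases hz : ∀ i ∈ S, X i = 0
    · exact mem_remainderSpace_of_forall_eq_zero U hz hspan f
    push Not at hz
    obtain ⟨i, hi, hXi⟩ := hz
    have hcard : (S.erase i).card = N := by rw [Finset.card_erase_of_mem hi, hN]; rfl
    obtain ⟨m, L, hL, hker⟩ := exists_linearMap_ker_eq (Submodule.span ℝ {X i})
    have hLi : L (X i) = 0 := by
      rw [← LinearMap.mem_ker, hker]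
      exact Submodule.mem_span_singleton_self _
    have hspanL : Submodule.span ℝ ((fun j => L (X j)) '' (S.erase i : Finset ι)) = ⊤ := by
      rw [eq_top_iff, ← hL, LinearMap.range_eq_map, ← hspan, Submodule.map_span, Submodule.span_le]
      rintro _ ⟨_, ⟨j, hj, rfl⟩, rfl⟩
      by_cases hji : j = i
      · rw [hji, hLi]
        exact zero_mem _
      · exact Submodule.subset_span ⟨j, by simpa [hji] using hj, rfl⟩
    -- The contraction step is kept general in `g`: it is applied to `f`, and again to the quotient
    -- of `f - h` by `p_x`.
    have hcon := fun {g : MvPolynomial (Fin n) ℂ} => exists_remainder_of_contraction (f := g) hi hL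
      hker (ih (fun j => L (X j)) (U.map L) (S.erase i) hspanL hcard)
    have hspan_le : Submodule.span ℂ {f | ∃ Y ⊆ S.erase i,
        U ≤ Submodule.span ℝ (X '' {j | j ∈ S ∧ j ∉ Y}) ∧ f = prodPoly X Y} ≤
          remainderSpace X U S := by
      refine Submodule.span_mono ?_
      rintro _ ⟨Y, hY, hU, rfl⟩
      exact ⟨Y, hY.trans (Finset.erase_subset i S), hU, rfl⟩
    obtain ⟨h, hh, g, hg⟩ := hcon fun η hη _ => mem_facetKernel.1 hf η hη
    have hh := hspan_le hh
    have hK : linPoly (X i) * g ∈ facetKernel X U S := by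
      rw [← hg]
      exact sub_mem hf (remainderSpace_le_facetKernel X U S hh)
    rw [mem_facetKernel] at hK
    suffices linPoly (X i) * g ∈ remainderSpace X U S by
      rw [← sub_add_cancel f h, hg]
      exact add_mem this hh
    -- When the deletion still spans, dividing by `p_x` lowers the required power exactly when `X i`
    -- is off the hyperplane, which is when deletion lowers the multiplicity.
    by_cases hdel : Submodule.span ℝ (X '' (S.erase i : Finset ι)) = ⊤
    · have hgK : g ∈ facetKernel X U (S.erase i) := by
        refine mem_facetKernel.2 fun η hη => ?_
        have hηS : IsFacetNormal X S η := by
          refine ⟨hη.1, fun v hv => Submodule.span_mono (Set.image_mono ?_) (hη.2 v hv)⟩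
          exact fun j hj => ⟨Finset.mem_of_mem_erase hj.1, hj.2⟩
        have h1 := hK η hηS
        by_cases h0 : η ⬝ᵥ X i = 0
        · rw [dirDerivEnd_pow_linPoly_mul_of_perp h0] at h1
          rw [normalMult_erase_of_perp h0]
          exact (mul_eq_zero.1 h1).resolve_left (linPoly_ne_zero hXi)
        · rw [normalMult_erase_of_not_perp hi h0, add_right_comm] at h1
          exact dirDerivEnd_pow_eq_zero_of_linPoly_mul h0 h1
      have hgR := ih X U (S.erase i) hdel hcard hgK
      have hle : remainderSpace X U (S.erase i) ≤
          (remainderSpace X U S).comap (LinearMap.mulLeft ℂ (linPoly (X i))) := by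
        refine Submodule.span_le.2 ?_
        rintro _ ⟨Y, hY, hU, rfl⟩
        exact prodPoly_insert_mem_remainderSpace hi hY hU
      exact hle hgR
    · obtain ⟨η, hη, hperp⟩ := exists_perp_of_ne_top hdel
      obtain ⟨hηi, hηspan⟩ := isFacetNormal_of_perp_erase hspan hη hperp
      have hηj : ∀ j ∈ S.erase i, η ⬝ᵥ X j = 0 := fun j hj =>
        hperp _ (Submodule.subset_span ⟨j, hj, rfl⟩)
      have hηS : IsFacetNormal X S η := by
        refine ⟨hη, fun v hv => Submodule.span_mono (Set.image_mono ?_) (hηspan v hv)⟩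
        exact fun j hj => ⟨Finset.mem_of_mem_erase hj, hηj j hj⟩
      have hmult : normalMult X S η = 1 := by
        rw [normalMult_erase_of_not_perp hi hηi, normalMult, Finset.card_eq_zero.2, zero_add]
        exact Finset.filter_eq_empty_iff.2 fun j hj h => h (hηj j hj)
      have hKη := hK η hηS
      rw [hmult] at hKη
      by_cases hU : ∀ u ∈ U, η ⬝ᵥ u = 0
      · obtain ⟨h', hh', hdvd⟩ := hcon (g := g) fun ξ hξ h0 => by
          have h1 := hK ξ hξ
          rw [dirDerivEnd_pow_linPoly_mul_of_perp h0] at h1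
          exact (mul_eq_zero.1 h1).resolve_left (linPoly_ne_zero hXi)
        have hDg : dirDerivEnd η g = 0 := by
          rw [perpIndicator, if_pos hU] at hKη
          simpa using dirDerivEnd_pow_eq_zero_of_linPoly_mul hηi hKη
        have hDh : dirDerivEnd η h' = 0 := by
          refine (Submodule.span_le (p := LinearMap.ker (dirDerivEnd η))).2 ?_ hh'
          rintro _ ⟨Y, hY, -, rfl⟩
          have h1 := dirDerivEnd_pow_prodPoly_eq_zero X η Y
          rw [Finset.filter_eq_empty_iff.2 fun j hj h => h (hηj j (hY hj))] at h1
          simpa using h1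
        -- `g - h'` is a multiple of `p_x` killed by `D_η`, and `p_x` varies along `η`; hence it is
        -- zero.
        have hgh : g = h' := by
          obtain ⟨q, hq⟩ := hdvd
          have h1 : (dirDerivEnd η ^ (0 + 1)) (linPoly (X i) * q) = 0 := by
            rw [← hq]
            simp [hDg, hDh]
          have h2 : q = 0 := by simpa using dirDerivEnd_pow_eq_zero_of_linPoly_mul hηi h1
          rw [h2, mul_zero] at hq
          exact sub_eq_zero.1 hq
        rw [hgh]
        refine (Submodule.span_le (p := (remainderSpace X U S).comap
          (LinearMap.mulLeft ℂ (linPoly (X i))))).2 ?_ hh'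
        rintro _ ⟨Y, hY, hUY, rfl⟩
        -- Since `U` and all other vectors lie in `η⊥` while `X i` does not, `X i` does not
        -- contribute to spanning `U` and may be moved into the product.
        refine prodPoly_insert_mem_remainderSpace hi hY fun u hu => ?_
        obtain ⟨a, w, hw, huw⟩ := span_image_split (i := i)
          (t := {j | j ∈ S.erase i ∧ j ∉ Y}) (fun j hj => by
            by_cases hji : j = i
            · exact Or.inl hji
            · exact Or.inr ⟨Finset.mem_erase.2 ⟨hji, hj.1⟩, hj.2⟩) (hUY hu)
        have hw0 : η ⬝ᵥ w = 0 := dotProduct_eq_zero_of_mem_span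
          (by rintro _ ⟨j, hj, rfl⟩; exact hηj j hj.1) hw
        have h0 := hU u hu
        rw [huw, dotProduct_add, hw0, dotProduct_smul, add_zero, smul_eq_mul] at h0
        rw [huw, (mul_eq_zero.1 h0).resolve_right hηi]
        simpa using hw
      · rw [perpIndicator, if_neg hU] at hKη
        have h2 : g = 0 := by
          simpa using dirDerivEnd_pow_eq_zero_of_linPoly_mul (k := 0) hηi hKη
        rw [h2, mul_zero]
        exact zero_mem _

/-! ### Apolar duality -/

/-- The homogeneous polynomial of degree `N` that represents the functional `lam` in degree `N` for
the pairing `⟨p, q⟩ = p(D) q (0)`. -/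
noncomputable def apolar {n : ℕ} (lam : MvPolynomial (Fin n) ℂ →ₗ[ℂ] ℂ) (N : ℕ) :
    MvPolynomial (Fin n) ℂ :=
  ∑ α ∈ Finset.finsuppAntidiag Finset.univ N,
    monomial α (lam (monomial α 1) / ((∏ i, (α i)! : ℕ) : ℂ))

theorem coeff_apolar {n : ℕ} (lam : MvPolynomial (Fin n) ℂ →ₗ[ℂ] ℂ) (N : ℕ) (α : Fin n →₀ ℕ) :
    coeff α (apolar lam N) =
      if α.degree = N then lam (monomial α 1) / ((∏ i, (α i)! : ℕ) : ℂ) else 0 := by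
  classical
  have hmem : α ∈ Finset.finsuppAntidiag Finset.univ N ↔ α.degree = N := by
    rw [Finset.mem_finsuppAntidiag, Finsupp.degree_eq_sum]
    simp
  simp only [apolar, coeff_sum, coeff_monomial]
  rw [Finset.sum_ite_eq']
  simp only [hmem]

theorem apolar_isHomogeneous {n : ℕ} (lam : MvPolynomial (Fin n) ℂ →ₗ[ℂ] ℂ) (N : ℕ) :
    (apolar lam N).IsHomogeneous N := by
  intro α hα
  rw [coeff_apolar] at hα
  by_contra h
  refine hα (if_neg fun hdeg => h ?_)
  rw [← hdeg, Finsupp.degree_eq_weight_one]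
  rfl

/-- Differentiation is adjoint to multiplication by the variable; the factorial weights absorb the
exponent it produces. -/
theorem pderiv_apolar_succ {n : ℕ} (lam : MvPolynomial (Fin n) ℂ →ₗ[ℂ] ℂ) (N : ℕ) (i : Fin n) :
    pderiv i (apolar lam (N + 1)) = apolar (lam ∘ₗ LinearMap.mulLeft ℂ (X i)) N := by
  ext β
  have hdeg : (β + Finsupp.single i 1).degree = β.degree + 1 := by simp
  have hfac : ∏ j, ((β + Finsupp.single i 1 : Fin n →₀ ℕ) j)! = (β i + 1) * ∏ j, (β j)! := by
    rw [← Finset.mul_prod_erase _ _ (Finset.mem_univ i),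
      ← Finset.mul_prod_erase _ (fun j => (β j)!) (Finset.mem_univ i), ← mul_assoc]
    congr 1
    · simp [Nat.factorial_succ]
    · refine Finset.prod_congr rfl fun j hj => ?_
      simp [(Finset.ne_of_mem_erase hj).symm]
  rw [coeff_pderiv, coeff_apolar, coeff_apolar, hdeg, hfac]
  have hX : X i * monomial β (1 : ℂ) = monomial (β + Finsupp.single i 1) 1 := by
    rw [X, monomial_mul, add_comm, one_mul]
  have h0 : ((β i : ℂ) + 1) ≠ 0 := Nat.cast_add_one_ne_zero _
  simp only [add_left_inj, LinearMap.comp_apply, LinearMap.mulLeft_apply, hX]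
  split_ifs
  · have h1 : ((∏ j, (β j)! : ℕ) : ℂ) ≠ 0 :=
      Nat.cast_ne_zero.2 (Finset.prod_ne_zero_iff.2 fun j _ => Nat.factorial_ne_zero _)
    rw [Nat.cast_mul, Nat.cast_add, Nat.cast_one]
    field_simp
  · rw [zero_mul]

theorem dirDerivEnd_apolar_succ {n : ℕ} (lam : MvPolynomial (Fin n) ℂ →ₗ[ℂ] ℂ) (N : ℕ)
    (η : Fin n → ℝ) :
    dirDerivEnd η (apolar lam (N + 1)) = apolar (lam ∘ₗ LinearMap.mulLeft ℂ (linPoly η)) N := by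
  rw [dirDerivEnd_eq_sum]
  simp only [pderiv_apolar_succ]
  ext β
  simp only [coeff_sum, coeff_smul, coeff_apolar, LinearMap.comp_apply, LinearMap.mulLeft_apply]
  split_ifs
  · simp only [linPoly, Finset.sum_mul, map_sum, Finset.sum_div, smul_eq_mul]
    refine Finset.sum_congr rfl fun i _ => ?_
    rw [mul_assoc, ← smul_eq_C_mul, map_smul, smul_eq_mul, mul_div_assoc]
  · simp

theorem dirDerivEnd_apolar_zero {n : ℕ} (lam : MvPolynomial (Fin n) ℂ →ₗ[ℂ] ℂ) (η : Fin n → ℝ) :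
    dirDerivEnd η (apolar lam 0) = 0 := by
  have h := apolar_isHomogeneous lam 0
  rw [← totalDegree_zero_iff_isHomogeneous, totalDegree_eq_zero_iff_eq_C] at h
  rw [h, dirDerivEnd_C]

theorem dirDerivEnd_pow_apolar_eq_zero {n : ℕ} {η : Fin n → ℝ} {k : ℕ}
    {lam : MvPolynomial (Fin n) ℂ →ₗ[ℂ] ℂ} (h : ∀ p, lam (linPoly η ^ k * p) = 0) (N : ℕ) :
    (dirDerivEnd η ^ k) (apolar lam N) = 0 := by
  induction k generalizing lam N with
  | zero =>
    ext α
    have := h (monomial α 1)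
    rw [pow_zero, one_mul] at this
    simp [coeff_apolar, this]
  | succ k ih =>
    rw [pow_succ, Module.End.mul_apply]
    cases N with
    | zero => rw [dirDerivEnd_apolar_zero, map_zero]
    | succ N =>
      rw [dirDerivEnd_apolar_succ]
      refine ih (fun p => ?_) N
      rw [LinearMap.comp_apply, LinearMap.mulLeft_apply, ← mul_assoc, ← pow_succ', h]

/-- An ideal contains all homogeneous polynomials of degree `N` if no nonzero homogeneous
polynomial of degree `N` is annihilated by the `D_η ^ k` with `p_η ^ k` in the ideal. -/
theorem mem_ideal_of_isHomogeneous {n N : ℕ} {J : Ideal (MvPolynomial (Fin n) ℂ)}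
    (hJ : ∀ f : MvPolynomial (Fin n) ℂ, f.IsHomogeneous N →
      (∀ (η : Fin n → ℝ) (k : ℕ), linPoly η ^ k ∈ J → (dirDerivEnd η ^ k) f = 0) → f = 0)
    {q : MvPolynomial (Fin n) ℂ} (hq : q.IsHomogeneous N) : q ∈ J := by
  by_contra hqJ
  -- Take a functional that vanishes on `J` but not at `q`. Its apolar form satisfies the derivative
  -- conditions, so it is zero, and then the functional vanishes on every monomial of degree `N`.
  obtain ⟨lam, hlq, hlJ⟩ := Submodule.exists_le_ker_of_notMem
    (p := J.restrictScalars ℂ) (v := q) hqJ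
  have h0 := hJ (apolar lam N) (apolar_isHomogeneous lam N) fun η k hk =>
    dirDerivEnd_pow_apolar_eq_zero (fun p => hlJ (J.mul_mem_right p hk)) N
  apply hlq
  rw [q.as_sum, map_sum]
  refine Finset.sum_eq_zero fun α hα => ?_
  have hdeg : α.degree = N := by
    rw [Finsupp.degree_eq_weight_one]
    exact hq (mem_support_iff.1 hα)
  have h1 := congrArg (coeff α) h0
  rw [coeff_apolar, if_pos hdeg, coeff_zero, div_eq_zero_iff] at h1
  have h2 := h1.resolve_right
    (Nat.cast_ne_zero.2 (Finset.prod_ne_zero_iff.2 fun j _ => Nat.factorial_ne_zero _))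
  rw [← mul_one (coeff α q), ← smul_eq_mul, ← smul_monomial, map_smul, h2, smul_zero]

/-- Since `p_Y` has degree `#Y`, only `Y = S` reaches degree `#S`. -/
theorem mem_span_prodPoly_of_isHomogeneous {n : ℕ} {ι : Type*} {X : ι → Fin n → ℝ}
    {U : Submodule ℝ (Fin n → ℝ)} {S : Finset ι} {f : MvPolynomial (Fin n) ℂ}
    (hf : f.IsHomogeneous S.card) (hfR : f ∈ remainderSpace X U S) :
    f ∈ Submodule.span ℂ {prodPoly X S} := by
  have hle : remainderSpace X U S ≤
      (Submodule.span ℂ {prodPoly X S}).comap (homogeneousComponent S.card) := by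
    refine Submodule.span_le.2 ?_
    rintro _ ⟨Y, hY, -, rfl⟩
    rw [SetLike.mem_coe, Submodule.mem_comap,
      homogeneousComponent_of_mem (prodPoly_isHomogeneous X Y)]
    split_ifs with h
    · rw [Finset.eq_of_subset_of_card_le hY h.le]
      exact Submodule.mem_span_singleton_self _
    · exact zero_mem _
  have h := hle hfR
  rwa [Submodule.mem_comap, homogeneousComponent_of_mem hf, if_pos rfl] at h

/-- If an ideal contains the powers `p_η ^ (m(F) + 1)` for all facet hyperplanes `F = η⊥` and
`p_η ^ m(F)` for one of them, then it contains all homogeneous polynomials of degree `#S`. -/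
theorem mem_ideal_of_facet_powers {n : ℕ} {ι : Type*} [DecidableEq ι] {X : ι → Fin n → ℝ}
    {S : Finset ι} (hX : ∀ i ∈ S, X i ≠ 0) (hspan : Submodule.span ℝ (X '' S) = ⊤)
    {J : Ideal (MvPolynomial (Fin n) ℂ)}
    (hJ : ∀ η, IsFacetNormal X S η → linPoly η ^ (normalMult X S η + 1) ∈ J)
    {η₀ : Fin n → ℝ} (hη₀ : linPoly η₀ ^ normalMult X S η₀ ∈ J)
    {q : MvPolynomial (Fin n) ℂ} (hq : q.IsHomogeneous S.card) : q ∈ J := by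
  refine mem_ideal_of_isHomogeneous (fun f hf hfJ => ?_) hq
  have hfK : f ∈ facetKernel X ⊥ S := by
    refine mem_facetKernel.2 fun η hη => hfJ η _ ?_
    rw [perpIndicator, if_pos (by simp)]
    exact hJ η hη
  have hfs := mem_span_prodPoly_of_isHomogeneous hf (facetKernel_le_remainderSpace X ⊥ S hspan hfK)
  obtain ⟨c, rfl⟩ := Submodule.mem_span_singleton.1 hfs
  have h0 := hfJ η₀ _ hη₀
  rw [map_smul, smul_eq_zero] at h0
  rw [h0.resolve_right (dirDerivEnd_pow_prodPoly_ne_zero X η₀ S hX), zero_smul]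

/-! ### Polynomials on the orthogonal complement of a subspace -/

/-- A homogeneous polynomial annihilated by all `D_v`, `v ∈ ker L`, is a polynomial in the linear
forms `p_w` with `w` in the range of the transpose `A` of `L`. -/
theorem exists_linSubst_eq_of_perp {n m : ℕ} {L : (Fin n → ℝ) →ₗ[ℝ] (Fin m → ℝ)}
    (hL : LinearMap.range L = ⊤) {A : (Fin m → ℝ) →ₗ[ℝ] (Fin n → ℝ)}
    (hA : ∀ ξ v, A ξ ⬝ᵥ v = ξ ⬝ᵥ L v) {k : ℕ} {q : MvPolynomial (Fin n) ℂ}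
    (hq : q.IsHomogeneous k) (hqL : ∀ v ∈ LinearMap.ker L, dirDerivEnd v q = 0) :
    ∃ r : MvPolynomial (Fin m) ℂ, r.IsHomogeneous k ∧ linSubst A r = q := by
  obtain ⟨σ, hσ⟩ := L.exists_rightInverse_of_surjective hL
  induction k generalizing q with
  | zero =>
    rw [← totalDegree_zero_iff_isHomogeneous, totalDegree_eq_zero_iff_eq_C] at hq
    exact ⟨C (coeff 0 q), isHomogeneous_C _ _, by rw [hq]; simp [linSubst]⟩
  | succ k ih =>
    have hD : ∀ j : Fin m, ∃ r : MvPolynomial (Fin m) ℂ, r.IsHomogeneous k ∧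
        linSubst A r = dirDerivEnd (σ (Pi.single j 1)) q := fun j =>
      ih (dirDerivEnd_isHomogeneous _ hq) fun v hv => by
        rw [dirDerivEnd_comm, hqL v hv, map_zero]
    choose r hr hrq using hD
    -- Modulo `ker L`, where `q` has zero derivative, `e_i` equals `σ (L e_i)`. Euler's identity
    -- then rebuilds `q` from derivatives already known to be pulled back.
    have hpd : ∀ i : Fin n, pderiv i q = ∑ j, ((L (Pi.single i 1) j : ℝ) : ℂ) •
        dirDerivEnd (σ (Pi.single j 1)) q := by
      intro i
      rw [← dirDerivEnd_sum_smul_left]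
      have h1 : (Pi.single i 1 : Fin n → ℝ) =
          ((Pi.single i 1 : Fin n → ℝ) - σ (L (Pi.single i 1))) + σ (L (Pi.single i 1)) := by simp
      have h2 : (Pi.single i 1 : Fin n → ℝ) - σ (L (Pi.single i 1)) ∈ LinearMap.ker L := by
        have := LinearMap.congr_fun hσ (L (Pi.single i 1))
        rw [LinearMap.comp_apply, LinearMap.id_apply] at this
        rw [LinearMap.mem_ker, map_sub, this, sub_self]
      rw [← dirDerivEnd_single]
      conv_lhs => rw [h1, dirDerivEnd_add_left, hqL _ h2, zero_add,
        pi_eq_sum_univ' (L (Pi.single i 1)), map_sum]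
      simp only [map_smul]
    have hAe : ∀ j : Fin m, linPoly (A (Pi.single j 1)) =
        ∑ i, C ((L (Pi.single i 1) j : ℝ) : ℂ) * X i := by
      intro j
      refine Finset.sum_congr rfl fun i _ => ?_
      have := hA (Pi.single j 1) (Pi.single i 1)
      simp only [dotProduct_single, mul_one, single_dotProduct, one_mul] at this
      rw [this]
    have heuler := hq.sum_X_mul_pderiv
    have hsum : linSubst A (∑ j, X j * r j) = (k + 1) • q := by
      rw [← heuler, map_sum]
      simp only [hpd, map_mul, linSubst_X, hrq, hAe, Finset.sum_mul, Finset.mul_sum]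
      rw [Finset.sum_comm]
      refine Finset.sum_congr rfl fun i _ => Finset.sum_congr rfl fun j _ => ?_
      rw [smul_eq_C_mul]
      ring
    refine ⟨((k + 1 : ℕ) : ℂ)⁻¹ • ∑ j, X j * r j, ?_, ?_⟩
    · rw [smul_eq_C_mul]
      have h1 : (∑ j, X j * r j).IsHomogeneous (k + 1) :=
        IsHomogeneous.sum _ _ _ fun j _ => by
          rw [add_comm]
          exact (isHomogeneous_X ℂ j).mul (hr j)
      simpa using (isHomogeneous_C (Fin m) (((k + 1 : ℕ) : ℂ)⁻¹)).mul h1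
    · rw [map_smul, hsum, ← Nat.cast_smul_eq_nsmul ℂ, smul_smul, inv_mul_cancel₀, one_smul]
      exact Nat.cast_ne_zero.2 k.succ_ne_zero

/-! ### Facet hyperplanes and their normals -/

theorem spanOf_mono {n : ℕ} {ι : Type*} (X : ι → Fin n → ℝ) {Y Z : Finset ι} (h : Y ⊆ Z) :
    spanOf X Y ≤ spanOf X Z :=
  Submodule.span_mono (Set.image_mono (Finset.coe_subset.2 h))

theorem mem_spanOf {n : ℕ} {ι : Type*} (X : ι → Fin n → ℝ) {Y : Finset ι} {i : ι} (h : i ∈ Y) :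
    X i ∈ spanOf X Y :=
  Submodule.subset_span ⟨i, h, rfl⟩

theorem mem_indepSets_iff {n : ℕ} {ι : Type*} {X : ι → Fin n → ℝ} {I : Finset ι} :
    I ∈ indepSets X ↔ LinearIndepOn ℝ X (I : Set ι) :=
  Iff.rfl

/-- An independent set extends, within any larger set, to an independent set with the same
span. -/
theorem exists_indepSets_extension {n : ℕ} {ι : Type*} {X : ι → Fin n → ℝ}
    {I T : Finset ι} (hI : I ∈ indepSets X) (hIT : I ⊆ T) :
    ∃ J ∈ indepSets X, I ⊆ J ∧ J ⊆ T ∧ spanOf X J = spanOf X T := by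
  obtain ⟨b, hbT, hIb, hspan, hb⟩ := exists_linearIndepOn_extension
    (mem_indepSets_iff.1 hI) (Finset.coe_subset.2 hIT)
  lift b to Finset ι using T.finite_toSet.subset hbT
  refine ⟨b, hb, Finset.coe_subset.1 hIb, Finset.coe_subset.1 hbT, le_antisymm ?_ ?_⟩
  · exact spanOf_mono X (Finset.coe_subset.1 hbT)
  · exact Submodule.span_le.2 hspan

theorem empty_mem_indepSets {n : ℕ} {ι : Type*} (X : ι → Fin n → ℝ) : ∅ ∈ indepSets X := by
  rw [mem_indepSets_iff, Finset.coe_empty]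
  exact linearIndepOn_empty ℝ X

theorem exists_indepSets_spanOf_eq {n : ℕ} {ι : Type*} (X : ι → Fin n → ℝ) (T : Finset ι) :
    ∃ J ∈ indepSets X, J ⊆ T ∧ spanOf X J = spanOf X T := by
  obtain ⟨J, hJ, -, hJT, hspan⟩ :=
    exists_indepSets_extension (empty_mem_indepSets X) (Finset.empty_subset T)
  exact ⟨J, hJ, hJT, hspan⟩

theorem finrank_perp_add_one {n : ℕ} {η : Fin n → ℝ} (hη : η ≠ 0)
    {F : Submodule ℝ (Fin n → ℝ)} (hF : ∀ v, v ∈ F ↔ η ⬝ᵥ v = 0) :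
    Module.finrank ℝ F + 1 = n := by
  have hne : dotProductBilin ℝ ℝ η ≠ 0 := fun h =>
    hη (dotProduct_eq_zero_iff.1 fun w => LinearMap.congr_fun h w)
  have hker : F = LinearMap.ker (dotProductBilin ℝ ℝ η) := by
    ext v
    exact hF v
  rw [hker]
  simpa using Module.Dual.finrank_ker_add_one_of_ne_zero hne

theorem mem_facet_iff {n : ℕ} {ι : Type*} {X : ι → Fin n → ℝ} {F : Submodule ℝ (Fin n → ℝ)}
    (hF : F ∈ facets X) {η : Fin n → ℝ} (hη : η ≠ 0) (hperp : ∀ v ∈ F, η ⬝ᵥ v = 0)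
    (v : Fin n → ℝ) : v ∈ F ↔ η ⬝ᵥ v = 0 := by
  have hle : F ≤ LinearMap.ker (dotProductBilin ℝ ℝ η) := hperp
  have h1 := finrank_perp_add_one hη (F := LinearMap.ker (dotProductBilin ℝ ℝ η))
    fun v => Iff.rfl
  rw [Submodule.eq_of_le_of_finrank_eq hle (by have := hF.2; omega)]
  rfl

/-- The span of the members of the family on the hyperplane `η⊥`. -/
def facetOf {n : ℕ} {ι : Type*} (X : ι → Fin n → ℝ) (η : Fin n → ℝ) :
    Submodule ℝ (Fin n → ℝ) :=
  Submodule.span ℝ (X '' {i | η ⬝ᵥ X i = 0})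

theorem dotProduct_eq_zero_of_mem_facetOf {n : ℕ} {ι : Type*} {X : ι → Fin n → ℝ}
    {η v : Fin n → ℝ} (hv : v ∈ facetOf X η) : η ⬝ᵥ v = 0 :=
  dotProduct_eq_zero_of_mem_span (by rintro _ ⟨i, hi, rfl⟩; exact hi) hv

theorem mem_facetOf_iff {n : ℕ} {ι : Type*} [Fintype ι] {X : ι → Fin n → ℝ} {η : Fin n → ℝ}
    (h : IsFacetNormal X Finset.univ η) (v : Fin n → ℝ) : v ∈ facetOf X η ↔ η ⬝ᵥ v = 0 := by
  refine ⟨dotProduct_eq_zero_of_mem_facetOf, fun hv => ?_⟩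
  simpa [facetOf] using h.2 v hv

theorem facetOf_mem_facets {n : ℕ} {ι : Type*} [Fintype ι] {X : ι → Fin n → ℝ} {η : Fin n → ℝ}
    (h : IsFacetNormal X Finset.univ η) : facetOf X η ∈ facets X := by
  classical
  refine ⟨⟨Finset.univ.filter fun i => η ⬝ᵥ X i = 0, ?_⟩,
    finrank_perp_add_one h.1 (mem_facetOf_iff h)⟩
  simp [facetOf, spanOf]

theorem mult_eq_normalMult {n : ℕ} {ι : Type*} [Fintype ι] {X : ι → Fin n → ℝ}
    {F : Submodule ℝ (Fin n → ℝ)} {η : Fin n → ℝ} (h : ∀ v, v ∈ F ↔ η ⬝ᵥ v = 0) :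
    mult X F = normalMult X Finset.univ η := by
  rw [mult, normalMult, ← Set.ncard_coe_finset]
  simp [h]

theorem linPoly_pow_mem_facetIdeal {n : ℕ} {ι : Type*} [Fintype ι] {X : ι → Fin n → ℝ}
    (e : Submodule ℝ (Fin n → ℝ) → ℕ) {η : Fin n → ℝ} (h : IsFacetNormal X Finset.univ η) :
    linPoly η ^ (normalMult X Finset.univ η + e (facetOf X η)) ∈ facetIdeal X e := by
  rw [← mult_eq_normalMult (mem_facetOf_iff h)]
  exact Ideal.subset_span ⟨_, facetOf_mem_facets h, η, h.1,
    fun v hv => dotProduct_eq_zero_of_mem_facetOf hv, rfl⟩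

theorem eps_le_one {n : ℕ} {ι : Type*} (X : ι → Fin n → ℝ) (E : Set (Finset ι))
    (F : Submodule ℝ (Fin n → ℝ)) : eps X E F ≤ 1 := by
  unfold eps
  split_ifs <;> simp

theorem extIdeal_le_facetIdeal {n : ℕ} {ι : Type*} (X : ι → Fin n → ℝ) (E : Set (Finset ι)) :
    extIdeal X ≤ facetIdeal X (eps X E) := by
  refine Ideal.span_le.2 ?_
  rintro _ ⟨F, hF, η, hη, hperp, rfl⟩
  exact Ideal.mem_of_dvd _ (pow_dvd_pow _ (Nat.add_le_add_left (eps_le_one X E F) _))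
    (Ideal.subset_span ⟨F, hF, η, hη, hperp, rfl⟩)

theorem dirDerivEnd_linPoly_pow_of_perp {n : ℕ} {η v : Fin n → ℝ} (h : η ⬝ᵥ v = 0) (k : ℕ) :
    dirDerivEnd v (linPoly η ^ k) = 0 := by
  induction k with
  | zero => simp
  | succ k ih =>
    rw [pow_succ', dirDerivEnd_mul, ih, dirDerivEnd_linPoly, dotProduct_comm, h]
    simp

/-- If `ε(F) = 0`, then `F` is a missing span and `p_η ^ m(F)` is itself one of the additional
generators. -/
theorem facetIdeal_eps_le_semiExtIdeal {n : ℕ} {ι : Type*} (X : ι → Fin n → ℝ)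
    (E : Set (Finset ι)) : facetIdeal X (eps X E) ≤ semiExtIdeal X E := by
  refine Ideal.span_le.2 ?_
  rintro _ ⟨F, hF, η, hη, hperp, rfl⟩
  by_cases hE : ∃ I ∈ E, F = spanOf X I
  · refine Ideal.mem_sup_left (Ideal.subset_span ⟨F, hF, η, hη, hperp, ?_⟩)
    rw [eps, if_pos hE]
  · obtain ⟨Y, rfl⟩ := hF.1
    obtain ⟨J, hJ, -, hJspan⟩ := exists_indepSets_spanOf_eq X Y
    refine Ideal.mem_sup_right (Ideal.subset_span (Set.mem_iUnion₂.2
      ⟨_, ⟨J, hJ, fun hJE => hE ⟨J, hJE, hJspan.symm⟩, hJspan.symm⟩, ?_, fun v hv => ?_⟩))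
    · rw [eps, if_neg hE, add_zero]
      simpa using (linPoly_isHomogeneous η).pow (mult X (spanOf X Y))
    · rw [← dirDerivEnd_apply]
      exact dirDerivEnd_linPoly_pow_of_perp (hperp v hv) _

/-! ### The ideal -/

theorem bases_subset_of_isSemiExternal {n : ℕ} {ι : Type*} {X : ι → Fin n → ℝ}
    {E : Set (Finset ι)} (hne : E.Nonempty) (hE : IsSemiExternal X E) : bases X ⊆ E := by
  rintro B ⟨hB, htop⟩
  obtain ⟨I, hI⟩ := hne
  exact hE.2 I hI B hB (htop ▸ le_top)

theorem eps_facet_eq_zero {n : ℕ} {ι : Type*} {X : ι → Fin n → ℝ} {E : Set (Finset ι)}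
    (hE : IsSemiExternal X E) {J : Finset ι} (hJ : J ∈ indepSets X) (hJE : J ∉ E) :
    eps X E (spanOf X J) = 0 := by
  refine if_neg ?_
  rintro ⟨I, hI, h⟩
  exact hJE (hE.2 I hI J hJ h.symm.le)

/-- If a facet hyperplane with `ε = 0` contains the independent set `I`, then the polynomials of
degree `#(X \ S)` on the orthogonal complement of `S = span I` lie in the facet ideal. -/
theorem homogPolysOnPerp_subset_facetIdeal {n : ℕ} {ι : Type*} [Fintype ι] [DecidableEq ι]
    {X : ι → Fin n → ℝ} (hrank : Submodule.span ℝ (Set.range X) = ⊤) (E : Set (Finset ι))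
    {I : Finset ι} {F : Submodule ℝ (Fin n → ℝ)} (hF : F ∈ facets X) (hIF : spanOf X I ≤ F)
    (hFE : eps X E F = 0) :
    homogPolysOnPerp (mult X (spanOf X I)) (spanOf X I) ⊆
      (facetIdeal X (eps X E) : Set (MvPolynomial (Fin n) ℂ)) := by
  classical
  rintro q ⟨hq, hqS⟩
  obtain ⟨m, L, hL, hker⟩ := exists_linearMap_ker_eq (spanOf X I)
  obtain ⟨A, hA⟩ := exists_transpose L
  obtain ⟨r, hr, rfl⟩ := exists_linSubst_eq_of_perp hL hA hq fun v hv => by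
    rw [dirDerivEnd_apply]
    exact hqS v (hker ▸ hv)
  -- These are the vectors outside `span I`: nonzero after contraction, and as many as the degree of
  -- `q`.
  set S : Finset ι := Finset.univ.filter fun i => L (X i) ≠ 0 with hS
  have hnot : ∀ i, i ∉ S → L (X i) = 0 := fun i hi => by simpa [hS] using hi
  have hcard : mult X (spanOf X I) = S.card := by
    rw [mult, ← Set.ncard_coe_finset, ← hker]
    simp [hS]
  rw [hcard] at hr
  have hspan : Submodule.span ℝ ((fun i => L (X i)) '' S) = ⊤ := by
    rw [eq_top_iff, ← hL, LinearMap.range_eq_map, ← hrank, Submodule.map_span, Submodule.span_le]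
    rintro _ ⟨_, ⟨i, rfl⟩, rfl⟩
    by_cases hi : i ∈ S
    · exact Submodule.subset_span ⟨i, hi, rfl⟩
    · rw [hnot i hi]
      exact zero_mem _
  have hnormalMult : ∀ ξ, normalMult (fun i => L (X i)) S ξ = normalMult X Finset.univ (A ξ) := by
    intro ξ
    rw [← normalMult_transpose (hA ξ), normalMult, normalMult]
    congr 1
    ext i
    simp only [Finset.mem_filter, Finset.mem_univ, true_and, and_iff_right_iff_imp]
    intro h
    by_contra hi
    exact h (by rw [hnot i hi, dotProduct_zero])
  have hnormal : ∀ ξ, IsFacetNormal (fun i => L (X i)) S ξ →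
      IsFacetNormal X Finset.univ (A ξ) := by
    intro ξ hξ
    refine isFacetNormal_transpose (Finset.subset_univ S) hL (hA ξ) ?_ hξ
    rw [hker]
    refine Submodule.span_mono (Set.image_mono fun i hi => ⟨Finset.mem_univ i, ?_⟩)
    have : X i ∈ LinearMap.ker L := hker ▸ mem_spanOf X hi
    rw [hA, LinearMap.mem_ker.1 this, dotProduct_zero]
  -- Because `ker L ⊆ F`, the image of `F` stays proper; the transpose of a normal to it is a normal
  -- of `F`.
  obtain ⟨ξ, hξ, hξF⟩ := exists_perp_of_ne_top (W := F.map L) (by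
    intro htop
    have h1 : F = ⊤ := by
      rw [← sup_eq_left.2 (hker.le.trans hIF), ← Submodule.comap_map_eq, htop,
        Submodule.comap_top]
    have h2 := hF.2
    rw [h1, finrank_top, Module.finrank_fin_fun] at h2
    omega)
  have hAξ : A ξ ≠ 0 := by
    intro h0
    refine hξ (dotProduct_eq_zero_iff.1 fun w => ?_)
    obtain ⟨v, rfl⟩ := LinearMap.range_eq_top.1 hL w
    rw [← hA, h0, zero_dotProduct]
  have hperp : ∀ v ∈ F, A ξ ⬝ᵥ v = 0 := fun v hv => by
    rw [hA]
    exact hξF _ (Submodule.mem_map_of_mem hv)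
  -- Pulling the ideal back to the quotient space makes `r` a form of degree `#S`, and `F` supplies
  -- the one lower power `m(F)`.
  change r ∈ (facetIdeal X (eps X E)).comap (linSubst A)
  refine mem_ideal_of_facet_powers (X := fun i => L (X i)) (S := S) (η₀ := ξ)
    (fun i hi => (Finset.mem_filter.1 hi).2) hspan (fun ζ hζ => ?_) ?_ hr
  · rw [Ideal.mem_comap, map_pow, linSubst_linPoly, hnormalMult]
    exact Ideal.mem_of_dvd _ (pow_dvd_pow _ (Nat.add_le_add_left (eps_le_one X E _) _))
      (linPoly_pow_mem_facetIdeal (eps X E) (hnormal ζ hζ))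
  · rw [Ideal.mem_comap, map_pow, linSubst_linPoly, hnormalMult]
    refine Ideal.subset_span ⟨F, hF, A ξ, hAξ, hperp, ?_⟩
    rw [hFE, mult_eq_normalMult (mem_facet_iff hF hAξ hperp), add_zero]

theorem semiExtIdeal_eq_facetIdeal {n : ℕ} {ι : Type*} [Fintype ι] [DecidableEq ι]
    {X : ι → Fin n → ℝ} (hrank : Submodule.span ℝ (Set.range X) = ⊤)
    {E : Set (Finset ι)} (hne : E.Nonempty) (hE : IsSemiExternal X E)
    (hM : ∀ I ∈ indepSets X, I ∉ bases X → facetExtensions X I ⊆ E → I ∈ E) :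
    semiExtIdeal X E = facetIdeal X (eps X E) := by
  refine le_antisymm (sup_le (extIdeal_le_facetIdeal X E) (Ideal.span_le.2 ?_))
    (facetIdeal_eps_le_semiExtIdeal X E)
  refine Set.iUnion₂_subset ?_
  rintro _ ⟨I, hI, hIE, rfl⟩
  have hIB : I ∉ bases X := fun h => hIE (bases_subset_of_isSemiExternal hne hE h)
  -- The contrapositive of `hM` yields a facet through `I` spanned by a set outside `E`.
  obtain ⟨J, ⟨hJ, hIJ, hJF⟩, hJE⟩ := Set.not_subset.1 (mt (hM I hI hIB) hIE)
  refine homogPolysOnPerp_subset_facetIdeal hrank E hJF (Submodule.span_le.2 ?_)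
    (eps_facet_eq_zero hE hJ hJE)
  rintro _ ⟨i, hi, rfl⟩
  exact hIJ i hi

/-! ### The space -/

theorem prodPoly_augment_map_inl {n : ℕ} {ι : Type*} (X : ι → Fin n → ℝ) (Z Y : Finset ι) :
    prodPoly (augment X Z) (Y.map Function.Embedding.inl) = prodPoly X Y := by
  simp [prodPoly, augment]

/-- Realize `p_Y` by the original copies. A minimal `I` disjoint from `Y` survives among the
originals, every vector of `Z` survives as an extra copy, and together they span. -/
theorem semiExtSpace_le {n : ℕ} {ι : Type*} [DecidableEq ι] (X : ι → Fin n → ℝ)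
    (E : Set (Finset ι)) :
    semiExtSpace X E ≤ ⨆ I ∈ {I : Finset ι | Minimal (fun J => J ∈ E) I},
      ⨅ Z ∈ completions X I, centralSpace (augment X Z) := by
  refine Submodule.span_le.2 ?_
  rintro _ ⟨Y, ⟨I₀, hI₀, hdisj⟩, rfl⟩
  obtain ⟨I, hII₀, hI⟩ := exists_minimal_le_of_wellFoundedLT (fun J => J ∈ E) I₀ hI₀
  refine Submodule.mem_iSup_of_mem I (Submodule.mem_iSup_of_mem hI ?_)
  simp only [Submodule.mem_iInf]
  intro Z hZ
  refine Submodule.subset_span ⟨Y.map Function.Embedding.inl, ?_,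
    (prodPoly_augment_map_inl X Z Y).symm⟩
  rw [eq_top_iff, ← hZ.2, spanOf, Submodule.span_le]
  rintro _ ⟨i, hi, rfl⟩
  refine Submodule.subset_span ?_
  rcases Finset.mem_union.1 (Finset.mem_coe.1 hi) with hi | hi
  · refine ⟨Sum.inl i, ?_, rfl⟩
    simpa using Finset.disjoint_right.1 hdisj (hII₀ hi)
  · exact ⟨Sum.inr ⟨i, hi⟩, by simp, rfl⟩

/-- The order of vanishing of `D_η` on the central space of an augmented family. -/
theorem dirDerivEnd_pow_centralSpace_augment {n : ℕ} {ι : Type*} [Fintype ι]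
    {X : ι → Fin n → ℝ} {Z : Finset ι} {η : Fin n → ℝ} (hη : η ≠ 0)
    {f : MvPolynomial (Fin n) ℂ} (hf : f ∈ centralSpace (augment X Z)) :
    (dirDerivEnd η ^ (normalMult X Finset.univ η + normalMult X Z η)) f = 0 := by
  classical
  have hcount : normalMult (augment X Z) Finset.univ η =
      normalMult X Finset.univ η + normalMult X Z η := by
    rw [normalMult, normalMult, normalMult, Finset.card_filter, Finset.card_filter,
      Finset.card_filter, Fintype.sum_sum_type]
    congr 1
    exact Finset.sum_coe_sort Z fun i => if η ⬝ᵥ X i ≠ 0 then 1 else 0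
  -- The central space is the case `U = ⊤`, where no hyperplane gets the additional power.
  have hperp : perpIndicator (⊤ : Submodule ℝ (Fin n → ℝ)) η = 0 :=
    if_neg fun h => hη (dotProduct_eq_zero_iff.1 fun w => h w trivial)
  have hle : centralSpace (augment X Z) ≤
      LinearMap.ker (dirDerivEnd η ^ (normalMult X Finset.univ η + normalMult X Z η)) := by
    refine Submodule.span_le.2 ?_
    rintro _ ⟨Y, hY, rfl⟩
    have hU : (⊤ : Submodule ℝ (Fin n → ℝ)) ≤
        Submodule.span ℝ (augment X Z '' {i | i ∈ Finset.univ ∧ i ∉ Y}) := by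
      rw [← hY]
      exact Submodule.span_mono (Set.image_mono fun i hi => ⟨Finset.mem_univ i, hi⟩)
    have := prodPoly_mem_ker_of_remainder (Finset.subset_univ Y) hU η
    rwa [hcount, hperp, add_zero] at this
  exact hle hf

theorem insert_mem_indepSets {n : ℕ} {ι : Type*} [DecidableEq ι] {X : ι → Fin n → ℝ}
    {J : Finset ι} (hJ : J ∈ indepSets X) {i : ι} (hi : X i ∉ spanOf X J) :
    insert i J ∈ indepSets X := by
  rw [mem_indepSets_iff, Finset.coe_insert]
  exact (mem_indepSets_iff.1 hJ).insert hi

/-- Extend `I` inside `I ∪ η⊥` as far as possible. If `I` leaves `η⊥` the result is already a basis,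
and all added vectors lie on `η⊥`; otherwise one vector off `η⊥` completes it. -/
theorem exists_completion {n : ℕ} {ι : Type*} [Fintype ι] [DecidableEq ι]
    {X : ι → Fin n → ℝ} (hrank : Submodule.span ℝ (Set.range X) = ⊤) {I : Finset ι}
    (hI : I ∈ indepSets X) {η : Fin n → ℝ} (hη : IsFacetNormal X Finset.univ η) :
    ∃ Z ∈ completions X I, normalMult X Z η ≤ perpIndicator (spanOf X I) η := by
  classical
  obtain ⟨J, hJ, hIJ, hJT, hJspan⟩ := exists_indepSets_extension (X := X) hI
    (T := I ∪ Finset.univ.filter fun i => η ⬝ᵥ X i = 0) Finset.subset_union_left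
  have hfacet : facetOf X η ≤ spanOf X J := by
    rw [hJspan]
    refine Submodule.span_mono (Set.image_mono fun i hi => ?_)
    rw [Set.mem_ofPred_eq] at hi
    simp [hi]
  have htop : ∀ {K : Finset ι} {i : ι}, J ⊆ K → i ∈ K → η ⬝ᵥ X i ≠ 0 → spanOf X K = ⊤ := by
    intro K i hJK hiK hi
    refine eq_top_iff.2 fun v _ => ?_
    have h1 : v - ((η ⬝ᵥ v) / (η ⬝ᵥ X i)) • X i ∈ facetOf X η := by
      rw [mem_facetOf_iff hη, dotProduct_sub, dotProduct_smul, smul_eq_mul, div_mul_cancel₀ _ hi,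
        sub_self]
    have h2 := add_mem (spanOf_mono X hJK (hfacet h1))
      (Submodule.smul_mem _ ((η ⬝ᵥ v) / (η ⬝ᵥ X i)) (mem_spanOf X hiK))
    simpa using h2
  by_cases hperp : ∀ u ∈ spanOf X I, η ⬝ᵥ u = 0
  · have hJη : ∀ j ∈ J, η ⬝ᵥ X j = 0 := by
      intro j hj
      rcases Finset.mem_union.1 (hJT hj) with h | h
      · exact hperp _ (mem_spanOf X h)
      · exact (Finset.mem_filter.1 h).2
    obtain ⟨i, hi⟩ : ∃ i, η ⬝ᵥ X i ≠ 0 := by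
      by_contra! hall
      refine hη.1 (dotProduct_eq_zero_iff.1 fun w => ?_)
      refine dotProduct_eq_zero_of_mem_span (s := Set.range X) ?_ (by rw [hrank]; trivial)
      rintro _ ⟨i, rfl⟩
      exact hall i
    have hiJ : X i ∉ spanOf X J := fun h => hi (dotProduct_eq_zero_of_mem_span
      (by rintro _ ⟨j, hj, rfl⟩; exact hJη j hj) h)
    -- A completion may overlap `I`; here the overlap lies on `η⊥` and does not count.
    refine ⟨insert i J, ?_, ?_⟩
    · rw [completions, Set.mem_ofPred_eq,
        Finset.union_eq_right.2 (hIJ.trans (Finset.subset_insert i J))]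
      exact ⟨insert_mem_indepSets hJ hiJ,
        htop (Finset.subset_insert i J) (Finset.mem_insert_self i J) hi⟩
    · rw [perpIndicator, if_pos hperp, normalMult, ← Finset.card_singleton i]
      refine Finset.card_le_card fun j hj => ?_
      rw [Finset.mem_filter, Finset.mem_insert] at hj
      exact Finset.mem_singleton.2 (hj.1.resolve_right fun h => hj.2 (hJη j h))
  · obtain ⟨i, hiI, hi⟩ : ∃ i ∈ I, η ⬝ᵥ X i ≠ 0 := by
      by_contra! hall
      refine hperp fun u hu => dotProduct_eq_zero_of_mem_span ?_ hu
      rintro _ ⟨i, hi, rfl⟩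
      exact hall i hi
    refine ⟨J \ I, ?_, ?_⟩
    · rw [completions, Set.mem_ofPred_eq, Finset.union_sdiff_of_subset hIJ]
      exact ⟨hJ, htop subset_rfl (hIJ hiI) hi⟩
    · rw [normalMult, Finset.card_eq_zero.2]
      · exact Nat.zero_le _
      · refine Finset.filter_eq_empty_iff.2 fun j hj h => h ?_
        rw [Finset.mem_sdiff] at hj
        exact (Finset.mem_filter.1 ((Finset.mem_union.1 (hJT hj.1)).resolve_left hj.2)).2

theorem iInf_centralSpace_le_semiExtSpace {n : ℕ} {ι : Type*} [Fintype ι] [DecidableEq ι]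
    {X : ι → Fin n → ℝ} (hrank : Submodule.span ℝ (Set.range X) = ⊤)
    {E : Set (Finset ι)} (hE : IsSemiExternal X E) {I : Finset ι} (hI : I ∈ E) :
    ⨅ Z ∈ completions X I, centralSpace (augment X Z) ≤ semiExtSpace X E := by
  intro f hf
  simp only [Submodule.mem_iInf] at hf
  have hfK : f ∈ facetKernel X (spanOf X I) Finset.univ := by
    refine mem_facetKernel.2 fun η hη => ?_
    obtain ⟨Z, hZ, hle⟩ := exists_completion hrank (hE.1 hI) hη
    exact dirDerivEnd_pow_eq_zero_of_le (Nat.add_le_add_left hle _)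
      (dirDerivEnd_pow_centralSpace_augment hη.1 (hf Z hZ))
  refine Submodule.span_mono ?_ (facetKernel_le_remainderSpace X (spanOf X I) Finset.univ
    (by simpa using hrank) hfK)
  rintro _ ⟨Y, -, hU, rfl⟩
  -- A basis of the span of the remaining vectors spans at least `span I`, so semi-externality puts
  -- it in `E`.
  obtain ⟨J, hJ, hJY, hJspan⟩ := exists_indepSets_spanOf_eq X Yᶜ
  refine ⟨Y, ⟨J, hE.2 I hI J hJ ?_, ?_⟩, rfl⟩
  · rw [hJspan]
    refine hU.trans (Submodule.span_mono (Set.image_mono fun i hi => ?_))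
    simpa using hi.2
  · exact Finset.disjoint_right.2 fun i hi => Finset.mem_compl.1 (hJY hi)

end Zonotopal

theorem theorem2p8 {n : ℕ} {ι : Type*} [Fintype ι] [DecidableEq ι]
    (X : ι → Fin n → ℝ) (hX : ∀ i, X i ≠ 0)
    (hrank : Submodule.span ℝ (Set.range X) = ⊤)
    (E : Set (Finset ι)) (hne : E.Nonempty) (hE : Zonotopal.IsSemiExternal X E)
    (hM : ∀ I ∈ Zonotopal.indepSets X, I ∉ Zonotopal.bases X →
      Zonotopal.facetExtensions X I ⊆ E → I ∈ E) :
    Zonotopal.semiExtIdeal X E = Zonotopal.facetIdeal X (Zonotopal.eps X E) ∧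
    Zonotopal.semiExtSpace X E =
      ⨆ I ∈ {I : Finset ι | Minimal (fun J => J ∈ E) I},
        ⨅ Z ∈ Zonotopal.completions X I,
          Zonotopal.centralSpace (Zonotopal.augment X Z) := by
  refine ⟨Zonotopal.semiExtIdeal_eq_facetIdeal hrank hne hE hM,
    le_antisymm (Zonotopal.semiExtSpace_le X E) (iSup₂_le fun I hI => ?_)⟩
  exact Zonotopal.iInf_centralSpace_le_semiExtSpace hrank hE hI.1
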